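/- Theorem 1.3 (Large Deviations for Nonstationary Products). Let $\mathbf K$ be a compact set (in the topology of weak convergence) of Borel probability measures on $\mathrm{SL}(d,\mathbb R)$. Let $|\cdot|$ be the Euclidean norm on $\mathbb R^d$, $\|\cdot\|$ the corresponding operator norm, and for $A\in \mathrm{SL}(d,\mathbb R)$ let $f_A:\mathbb{RP}^{d-1}\to\mathbb{RP}^{d-1}$ be the induced projective transformation. Assume: (finite moment condition) there are $\gamma>0$ and $C$ such that $\int \|A\|^{\gamma}\,d\mu(A)<C$ for all $\mu\in\mathbf K$; (measures condition) for no $\mu\in\mathbf K$ do there exist Borel probability measures $\nu_1,\nu_2$ on $\mathbb{RP}^{d-1}$ with $(f_A)_*\nu_1=\nu_2$ for $\mu$-almost every $A$; (spaces condition) for no $\mu\in\mathbf K$ do there exist $U,U'\subset\mathbb R^d$, each a union of a non-empty finite family of proper subspaces (that is, subspaces different from $\{0\}$ and $\mathbb R^d$), with $A(U)=U'$ for $\mu$-almost every $A$. For a sequence $\mu_1,\mu_2,\ldots\in\mathbf K$, let $(A_1,\dots,A_n)$ have the distribution $\mathbb P=\mu_1\times\dots\times\mu_n$ and put $T_n=A_nA_{n-1}\cdots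 A_1$ and $L_n=\mathbb E\log\|T_n\|$. Then $\log\|T_n\|$ is integrable for all $n$ and all such sequences, so that $L_n$ is well defined, and for every $\varepsilon>0$ there exist $\delta>0$ and $N\in\mathbb N$ such that for all $n\ge N$, all sequences $\mu_1,\mu_2,\ldots\in\mathbf K$ and all $v_0\in\mathbb R^d$ with $|v_0|=1$, $$\mathbb P\{|\log\|T_n\|-L_n|>\varepsilon n\}<e^{-\delta n}\quad\text{and}\quad \mathbb P\{|\log|T_nv_0|-L_n|>\varepsilon n\}<e^{-\delta n}.$$ -/

import Mathlib

open MeasureTheory Set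
open scoped LinearAlgebra.Projectivization

noncomputable section

namespace NonstatFurstenberg

/-- The group `SL(d, ℝ)`, with Mathlib's topology (as a subspace of the `d × d` matrices). -/
abbrev SL (d : ℕ) : Type := Matrix.SpecialLinearGroup (Fin d) ℝ

/-- `ℝ^d` with the Euclidean norm. -/
abbrev E (d : ℕ) : Type := EuclideanSpace ℝ (Fin d)

/-- The real projective space `ℝP^{d-1}` of lines in `ℝ^d`. -/
abbrev RP (d : ℕ) : Type := ℙ ℝ (E d)

/-- The Borel σ-algebra on `SL(d, ℝ)`. -/
instance instMeasurableSpaceSL (d : ℕ) : MeasurableSpace (SL d) := borel (SL d)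

instance instBorelSpaceSL (d : ℕ) : BorelSpace (SL d) := ⟨rfl⟩

/-- The usual topology of `ℝP^{d-1}`: the quotient topology from `ℝ^d ∖ {0}`. -/
instance instTopologicalSpaceRP (d : ℕ) : TopologicalSpace (RP d) :=
  TopologicalSpace.coinduced
    (fun v : {v : E d // v ≠ 0} => (Projectivization.mk ℝ v.1 v.2 : RP d)) inferInstance

/-- The Borel σ-algebra on `ℝP^{d-1}`. -/
instance instMeasurableSpaceRP (d : ℕ) : MeasurableSpace (RP d) := borel (RP d)

instance instBorelSpaceRP (d : ℕ) : BorelSpace (RP d) := ⟨rfl⟩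

/-- The linear map `v ↦ A v` of Euclidean space. Its norm `‖act A‖` is the operator norm of `A`
with respect to the Euclidean norm. -/
def act {d : ℕ} (A : SL d) : E d →L[ℝ] E d :=
  Matrix.toEuclideanCLM (n := Fin d) (𝕜 := ℝ) (A : Matrix (Fin d) (Fin d) ℝ)

theorem act_mul {d : ℕ} (A B : SL d) (v : E d) : act (A * B) v = act A (act B v) := by
  simp [act]

theorem act_injective {d : ℕ} (A : SL d) : Function.Injective (act A) := by
  apply Function.LeftInverse.injective (g := act A⁻¹)
  intro v
  rw [← act_mul, inv_mul_cancel]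
  simp [act]

/-- The projective transformation `f_A` of `ℝP^{d-1}` induced by `A`. -/
def projMap {d : ℕ} (A : SL d) : RP d → RP d :=
  Projectivization.map (act A : E d →ₗ[ℝ] E d) (act_injective A)

/-- `f_A` is continuous, so push-forwards of Borel measures under it are genuine push-forwards. -/
theorem continuous_projMap {d : ℕ} (A : SL d) : Continuous (projMap A) := by
  refine continuous_coinduced_dom.2 ?_
  have h : Continuous (fun v : {v : E d // v ≠ 0} =>
      (⟨act A v.1, fun h0 => v.2 (act_injective A (by simpa using h0))⟩ : {v : E d // v ≠ 0})) :=
    Continuous.subtype_mk ((act A).continuous.comp continuous_subtype_val) _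
  exact continuous_coinduced_rng.comp h

/-- Finite moment condition: there are `γ > 0` and `C` with `∫ ‖A‖^γ dμ(A) < C` for all `μ ∈ K`. -/
def FiniteMoment {d : ℕ} (K : Set (ProbabilityMeasure (SL d))) : Prop :=
  ∃ γ C : ℝ, 0 < γ ∧ ∀ μ ∈ K,
    ∫⁻ A, ENNReal.ofReal (‖act A‖ ^ γ) ∂(μ : Measure (SL d)) < ENNReal.ofReal C

/-- Measures condition: for no `μ ∈ K` are there Borel probability measures `ν₁`, `ν₂` on
`ℝP^{d-1}` such that `(f_A)_* ν₁ = ν₂` for `μ`-almost every `A`. -/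
def MeasuresCondition {d : ℕ} (K : Set (ProbabilityMeasure (SL d))) : Prop :=
  ∀ μ ∈ K, ¬ ∃ ν₁ ν₂ : Measure (RP d), IsProbabilityMeasure ν₁ ∧ IsProbabilityMeasure ν₂ ∧
    ∀ᵐ A ∂(μ : Measure (SL d)), Measure.map (projMap A) ν₁ = ν₂

/-- `U ⊆ ℝ^d` is the union of a non-empty finite family of proper subspaces, where a proper
subspace is one different from `{0}` and from `ℝ^d`. (The sets `∅` and `{0}` must not count:
every linear automorphism preserves them.) -/
def IsFiniteUnionOfProperSubspaces {d : ℕ} (U : Set (E d)) : Prop :=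
  ∃ S : Finset (Submodule ℝ (E d)), S.Nonempty ∧ (∀ W ∈ S, W ≠ ⊥ ∧ W ≠ ⊤) ∧
    U = ⋃ W ∈ S, (W : Set (E d))

/-- Spaces condition: for no `μ ∈ K` are there finite unions `U`, `U'` of proper subspaces of
`ℝ^d` such that `A(U) = U'` for `μ`-almost every `A`. -/
def SpacesCondition {d : ℕ} (K : Set (ProbabilityMeasure (SL d))) : Prop :=
  ∀ μ ∈ K, ¬ ∃ U U' : Set (E d), IsFiniteUnionOfProperSubspaces U ∧
    IsFiniteUnionOfProperSubspaces U' ∧ ∀ᵐ A ∂(μ : Measure (SL d)), act A '' U = U'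

/-- The product `T_n = A_n ⋯ A_2 A_1`, where `A_1, …, A_n` are the entries
`A 0, …, A (n - 1)` of the tuple `A`. -/
def prodT {d n : ℕ} (A : Fin n → SL d) : SL d := (List.ofFn A).reverse.prod

/-- The law `μ_1 × ⋯ × μ_n` of `(A_1, …, A_n)`, where `μ_1, μ_2, …` are `μ 0, μ 1, …`. -/
def law {d : ℕ} (μ : ℕ → ProbabilityMeasure (SL d)) (n : ℕ) : Measure (Fin n → SL d) :=
  Measure.pi fun i : Fin n => (μ i : Measure (SL d))

/-- `L_n = 𝔼 log ‖T_n‖`. -/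
def L {d : ℕ} (μ : ℕ → ProbabilityMeasure (SL d)) (n : ℕ) : ℝ :=
  ∫ A, Real.log ‖act (prodT A)‖ ∂(law μ n)

end NonstatFurstenberg

end

noncomputable section

namespace NonstatFurstenberg

open Filter Topology
open scoped ENNReal NNReal

variable {d : ℕ}

/-! The key fact is that `log ‖T_n‖` and `log |T_n v|` have nearly the same mean, up to `ε n`,
uniformly in the unit vector `v` and in the sequence of laws. Write `T_n = B T`, where `T` is the
product of the first `k` matrices. For some unit vector `w` depending on `B`, `|B u| ≥ ‖B‖ |⟨w,
u⟩|`, so growth is lost only when the direction of `T v` is close to the hyperplane orthogonal to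
`w`. For a suitable fixed `k` this is uniformly unlikely (`exists_conv_near_hyperplane_lt`), and `B`
is independent of `T`.

By compactness, that non-concentration reduces to `measure_tr_eq_zero`: a law on the sphere with an
infinite past charges no proper subspace. Otherwise take the least charged dimension, the largest
mass `m` in that dimension, and a law having the most subspaces of mass `m`. For almost every `A` in
the step leading to it, `A` maps the finite family of maximal subspaces of its predecessor onto its
own, against the spaces condition.

Uniformity in `v` then yields concentration. On a block of bounded length, a second-order expansion
bounds the exponential moment of `s (log |T_n v| - L_n)` by `exp (2 |s| ε n)` for small `s`. The
bound holds for every starting direction, so conditioning on the past multiplies such bounds over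
successive blocks. The resulting centre, a sum of block values of `L`, is within `O(ε n)` of `L_n`
by Jensen. Markov's inequality gives the vector estimate, and the standard basis vectors give the
norm estimate. -/

/-! ### Norm estimates for matrices of determinant one -/

theorem act_one : act (1 : SL d) = 1 := by
  simp [act]

theorem act_mul_eq (A B : SL d) : act (A * B) = act A * act B := by
  simp [act]

theorem act_inv_act (A : SL d) (v : E d) : act A⁻¹ (act A v) = v := by
  rw [← act_mul, inv_mul_cancel, act_one]; rfl

theorem act_act_inv (A : SL d) (v : E d) : act A (act A⁻¹ v) = v := by
  rw [← act_mul, mul_inv_cancel, act_one]; rfl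

theorem continuous_act : Continuous (act : SL d → E d →L[ℝ] E d) := by
  have h : Continuous (Matrix.toEuclideanCLM (n := Fin d) (𝕜 := ℝ) :
      Matrix (Fin d) (Fin d) ℝ → E d →L[ℝ] E d) :=
    LinearMap.continuous_of_finiteDimensional
      ((Matrix.toEuclideanCLM (n := Fin d) (𝕜 := ℝ)).toAlgEquiv.toLinearMap)
  exact h.comp continuous_subtype_val

instance : SecondCountableTopology (SL d) :=
  inferInstanceAs (SecondCountableTopology {A : Fin d → Fin d → ℝ // Matrix.det A = 1})

instance : TopologicalSpace.PseudoMetrizableSpace (SL d) :=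
  inferInstanceAs
    (TopologicalSpace.PseudoMetrizableSpace {A : Fin d → Fin d → ℝ // Matrix.det A = 1})


/-- The larger of the norms of `A` and `A⁻¹`. -/
def size (A : SL d) : ℝ := max ‖act A‖ ‖act A⁻¹‖

/-- The logarithm of `size A`; it bounds `|log ‖A v‖|` for all unit vectors `v`. -/
def height (A : SL d) : ℝ := Real.log (size A)

theorem continuous_size : Continuous (size : SL d → ℝ) :=
  (continuous_act.norm).max (continuous_act.comp continuous_inv).norm

theorem one_le_size [NeZero d] (A : SL d) : 1 ≤ size A := by
  have h1 : (1 : ℝ) ≤ ‖act A‖ * ‖act A⁻¹‖ := by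
    have := norm_mul_le (act A) (act A⁻¹)
    rw [← act_mul_eq, mul_inv_cancel, act_one, norm_one] at this
    exact this
  by_contra! h
  obtain ⟨h2, h3⟩ := max_lt_iff.1 h
  nlinarith [norm_nonneg (act A), norm_nonneg (act A⁻¹)]

theorem size_pos [NeZero d] (A : SL d) : 0 < size A := one_pos.trans_le (one_le_size A)

theorem height_nonneg [NeZero d] (A : SL d) : 0 ≤ height A := Real.log_nonneg (one_le_size A)

theorem continuous_height [NeZero d] : Continuous (height : SL d → ℝ) :=
  continuous_size.log fun A => (size_pos A).ne'

theorem size_mul_le [NeZero d] (A B : SL d) : size (A * B) ≤ size A * size B := by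
  have hA := size_pos A
  refine max_le ?_ ?_
  · rw [act_mul_eq]
    exact (norm_mul_le _ _).trans (by
      gcongr
      · exact le_max_left _ _
      · exact le_max_left _ _)
  · rw [mul_inv_rev, act_mul_eq, mul_comm (size A)]
    exact (norm_mul_le _ _).trans (by
      gcongr
      · exact (size_pos B).le
      · exact le_max_right _ _
      · exact le_max_right _ _)

theorem height_mul_le [NeZero d] (A B : SL d) : height (A * B) ≤ height A + height B := by
  rw [height, height, height, ← Real.log_mul (size_pos A).ne' (size_pos B).ne']
  exact Real.log_le_log (size_pos _) (size_mul_le A B)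

theorem norm_act_apply_le (A : SL d) (v : E d) : ‖act A v‖ ≤ size A * ‖v‖ :=
  ((act A).le_opNorm v).trans (by gcongr; exact le_max_left _ _)

theorem norm_le_size_mul (A : SL d) (v : E d) : ‖v‖ ≤ size A * ‖act A v‖ := by
  conv_lhs => rw [← act_inv_act A v]
  exact ((act A⁻¹).le_opNorm _).trans (by gcongr; exact le_max_right _ _)

theorem act_ne_zero (A : SL d) {v : E d} (hv : v ≠ 0) : act A v ≠ 0 := fun h =>
  hv (act_injective A (by simpa using h))

theorem abs_log_norm_act_apply_le [NeZero d] (A : SL d) {v : E d} (hv : ‖v‖ = 1) :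
    |Real.log ‖act A v‖| ≤ height A := by
  have hv0 : v ≠ 0 := by rintro rfl; simp at hv
  have hpos : 0 < ‖act A v‖ := norm_pos_iff.2 (act_ne_zero A hv0)
  have h1 := norm_act_apply_le A v
  have h2 := norm_le_size_mul A v
  rw [hv] at h1 h2
  rw [mul_one] at h1
  rw [abs_le]
  constructor
  · have := Real.log_le_log one_pos h2
    rw [Real.log_mul (size_pos A).ne' hpos.ne', Real.log_one] at this
    unfold height; linarith
  · exact Real.log_le_log hpos h1

theorem norm_act_pos [NeZero d] (A : SL d) : 0 < ‖act A‖ := by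
  rw [norm_pos_iff]
  intro h
  obtain ⟨v, hv⟩ := exists_ne (0 : E d)
  exact act_ne_zero A hv (by rw [h]; rfl)

theorem abs_log_norm_act_le [NeZero d] (A : SL d) : |Real.log ‖act A‖| ≤ height A := by
  have hpos := norm_act_pos A
  obtain ⟨v, hv⟩ := exists_norm_eq (E d) zero_le_one
  rw [abs_le]
  constructor
  · have h1 := (abs_le.1 (abs_log_norm_act_apply_le A hv)).1
    have hv0 : v ≠ 0 := by rintro rfl; simp at hv
    refine h1.trans (Real.log_le_log (norm_pos_iff.2 (act_ne_zero A hv0)) ?_)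
    simpa [hv] using (act A).le_opNorm v
  · exact Real.log_le_log hpos (le_max_left _ _)

theorem log_norm_act_apply_le {A : SL d} {v : E d} (hv : ‖v‖ = 1) :
    Real.log ‖act A v‖ ≤ Real.log ‖act A‖ := by
  have hv0 : v ≠ 0 := by rintro rfl; simp at hv
  refine Real.log_le_log (norm_pos_iff.2 (act_ne_zero A hv0)) ?_
  simpa [hv] using (act A).le_opNorm v

theorem log_norm_act_mul_le [NeZero d] (A B : SL d) :
    Real.log ‖act (A * B)‖ ≤ Real.log ‖act A‖ + Real.log ‖act B‖ := by
  rw [← Real.log_mul (norm_act_pos A).ne' (norm_act_pos B).ne']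
  refine Real.log_le_log (norm_act_pos _) ?_
  rw [act_mul_eq]
  exact norm_mul_le _ _

theorem act_apply (A : SL d) (v : E d) (i : Fin d) :
    act A v i = ∑ j, (A : Matrix (Fin d) (Fin d) ℝ) i j * v j := by
  rw [act, Matrix.ofLp_toEuclideanCLM]
  rfl

/-- The entries of a matrix are bounded by its operator norm. -/
theorem abs_entry_le (A : SL d) (i j : Fin d) : |(A : Matrix (Fin d) (Fin d) ℝ) i j| ≤ ‖act A‖ := by
  have h1 := (act A).le_opNorm (EuclideanSpace.single j 1)
  have h2 := PiLp.norm_apply_le (act A (EuclideanSpace.single j (1 : ℝ))) i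
  have h3 : (act A (EuclideanSpace.single j (1 : ℝ))) i = (A : Matrix (Fin d) (Fin d) ℝ) i j := by
    rw [act_apply]; simp
  rw [h3] at h2
  simpa using h2.trans h1

/-- The operator norm is bounded by the number of entries times the largest entry. -/
theorem norm_act_le_of_entry_le (A : SL d) {x : ℝ} (hx : 0 ≤ x)
    (h : ∀ i j, |(A : Matrix (Fin d) (Fin d) ℝ) i j| ≤ x) : ‖act A‖ ≤ d * d * x := by
  refine ContinuousLinearMap.opNorm_le_bound _ (by positivity) fun v => ?_
  have h4 : ∀ i, ‖(act A v) i‖ ≤ d * x * ‖v‖ := by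
    intro i
    rw [act_apply]
    refine (norm_sum_le _ _).trans ((Finset.sum_le_card_nsmul _ _ (x * ‖v‖) fun j _ => ?_).trans ?_)
    · rw [norm_mul]
      exact mul_le_mul (h i j) (PiLp.norm_apply_le v j) (norm_nonneg _) hx
    · simp [mul_assoc]
  have h5 : ‖act A v‖ ≤ ∑ i, ‖(act A v) i‖ := by
    rw [EuclideanSpace.norm_eq]
    refine Real.sqrt_le_iff.2 ⟨by positivity, ?_⟩
    exact Finset.sum_sq_le_sq_sum_of_nonneg fun i _ => norm_nonneg _
  refine h5.trans ((Finset.sum_le_card_nsmul _ _ _ fun i _ => h4 i).trans ?_)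
  simp [mul_assoc]

/-- Since the determinant is one, the inverse is the adjugate. Its entries are determinants whose
entries are bounded by `max 1 ‖A‖`. Hence a moment of `‖A‖` also controls `‖A⁻¹‖`. -/
theorem norm_act_inv_le (A : SL d) :
    ‖act A⁻¹‖ ≤ d * d * (d.factorial * (max 1 ‖act A‖) ^ d) := by
  refine norm_act_le_of_entry_le _ (by positivity) fun i j => ?_
  rw [Matrix.SpecialLinearGroup.coe_inv, Matrix.adjugate_apply]
  have := Matrix.det_le (A := (A : Matrix (Fin d) (Fin d) ℝ).updateRow j (Pi.single i 1))
    (abv := AbsoluteValue.abs) (x := max 1 ‖act A‖) (fun k l => ?_)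
  · simpa using this
  · rw [Matrix.updateRow_apply]
    split_ifs
    · by_cases hl : l = i
      · subst hl; simp
      · simp [hl]
    · exact (abs_entry_le A k l).trans (le_max_right _ _)

/-- `B` expands every unit vector that is not nearly orthogonal to a suitable unit vector by almost
the full norm of `B`. -/
theorem exists_unit_norm_mul_inner_le [NeZero d] (B : SL d) :
    ∃ w : E d, ‖w‖ = 1 ∧ ∀ u, ‖act B‖ * |inner ℝ w u| ≤ ‖act B u‖ := by
  have hB := norm_act_pos B
  set T := ContinuousLinearMap.adjoint (act B) with hT
  have hTn : ‖T‖ = ‖act B‖ := LinearIsometryEquiv.norm_map _ _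
  obtain ⟨y, hy, hmax⟩ := (isCompact_sphere (0 : E d) 1).exists_isMaxOn
    (NormedSpace.sphere_nonempty.2 zero_le_one) T.continuous.norm.continuousOn
  have hy1 : ‖y‖ = 1 := by simpa using hy
  have hle : ‖T‖ ≤ ‖T y‖ := by
    refine ContinuousLinearMap.opNorm_le_of_unit_norm (norm_nonneg _) fun x hx => ?_
    exact hmax (show x ∈ Metric.sphere (0 : E d) 1 by simpa using hx)
  have heq : ‖T y‖ = ‖act B‖ := le_antisymm (by simpa [hy1, hTn] using T.le_opNorm y) (hTn ▸ hle)
  -- With `y` a unit vector at which the adjoint attains its norm, `‖B‖ ⟨w, u⟩ = ⟨y, B u⟩`, which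
  -- Cauchy–Schwarz bounds by `|B u|`.
  refine ⟨‖act B‖⁻¹ • T y, ?_, fun u => ?_⟩
  · rw [norm_smul, heq, norm_inv, norm_norm, inv_mul_cancel₀ hB.ne']
  · rw [real_inner_smul_left, abs_mul, abs_of_pos (inv_pos.2 hB), mul_inv_cancel_left₀ hB.ne', hT,
      ContinuousLinearMap.adjoint_inner_left]
    simpa [hy1] using abs_real_inner_le_norm y (act B u)

/-! ### The law of the product -/

/-- The law on `SL(d, ℝ)` of the product `T_n`, as an iterated convolution. -/
def conv (μ : ℕ → ProbabilityMeasure (SL d)) : ℕ → Measure (SL d)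
  | 0 => Measure.dirac 1
  | n + 1 => (μ n : Measure (SL d)) ∗ₘ conv μ n

instance isProbabilityMeasure_conv (μ : ℕ → ProbabilityMeasure (SL d)) (n : ℕ) :
    IsProbabilityMeasure (conv μ n) := by
  induction n with
  | zero => unfold conv; infer_instance
  | succ n ih => unfold conv; infer_instance

theorem prodT_succ {n : ℕ} (A : Fin (n + 1) → SL d) :
    prodT A = A (Fin.last n) * prodT fun i => A i.castSucc := by
  simp only [prodT, List.ofFn_succ', List.concat_eq_append, List.reverse_append,
    List.reverse_singleton, List.prod_append, List.prod_singleton]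

theorem continuous_prodT (n : ℕ) : Continuous (prodT : (Fin n → SL d) → SL d) := by
  induction n with
  | zero => exact continuous_of_const fun A B => by rw [Subsingleton.elim A B]
  | succ n ih =>
    simp only [funext prodT_succ]
    exact (continuous_apply _).mul (ih.comp (continuous_pi fun i => continuous_apply _))

theorem map_prodT_law (μ : ℕ → ProbabilityMeasure (SL d)) (n : ℕ) :
    (law μ n).map prodT = conv μ n := by
  induction n with
  | zero =>
    rw [law, Measure.pi_of_empty, Measure.map_dirac' (continuous_prodT 0).measurable]
    simp [conv, prodT]
  | succ n ih =>
    have h := measurePreserving_piFinSuccAbove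
      (fun i : Fin (n + 1) => (μ i : Measure (SL d))) (Fin.last n)
    have h2 : (prodT : (Fin (n + 1) → SL d) → SL d) =
        (fun p : SL d × SL d => p.1 * p.2) ∘ Prod.map id prodT ∘
          MeasurableEquiv.piFinSuccAbove (fun _ => SL d) (Fin.last n) := by
      ext1 A
      rw [prodT_succ]
      simp [MeasurableEquiv.piFinSuccAbove, Fin.init_def]
    have hm : Measurable (Prod.map id prodT : SL d × (Fin n → SL d) → SL d × SL d) :=
      measurable_id.prodMap (continuous_prodT n).measurable
    rw [h2, ← Measure.map_map measurable_mul (hm.comp (MeasurableEquiv.measurable _)),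
      ← Measure.map_map hm (MeasurableEquiv.measurable _), law, h.map_eq,
      ← Measure.map_prod_map _ _ measurable_id (continuous_prodT n).measurable, Measure.map_id]
    simp only [Fin.succAbove_last, Fin.val_castSucc, Fin.val_last]
    rw [show Measure.pi (fun j : Fin n => (μ j : Measure (SL d))) = law μ n from rfl, ih]
    rfl

/-- Later matrices stand on the left and follow the shifted sequence, which again lies in `K`; all
block arguments cut the product this way. -/
theorem conv_add (μ : ℕ → ProbabilityMeasure (SL d)) (k r : ℕ) :
    conv μ (k + r) = conv (fun i => μ (k + i)) r ∗ₘ conv μ k := by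
  induction r with
  | zero => simp [conv]
  | succ r ih =>
    rw [← add_assoc, conv, ih, conv, Measure.mconv_assoc]

/-! ### Exponential moments -/

/-- A uniform exponential moment of `height`. -/
structure ExpMoment (K : Set (ProbabilityMeasure (SL d))) (β M : ℝ) : Prop where
  pos : 0 < β
  one_le : 1 ≤ M
  lintegral_le : ∀ μ ∈ K,
    ∫⁻ A, ENNReal.ofReal (Real.exp (β * height A)) ∂(μ : Measure (SL d)) ≤ ENNReal.ofReal M

theorem size_le [NeZero d] (A : SL d) :
    size A ≤ d * d * d.factorial * max 1 ‖act A‖ ^ d := by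
  refine max_le ?_ ((norm_act_inv_le A).trans_eq (by ring))
  have h1 : (1 : ℝ) ≤ d := by exact_mod_cast NeZero.one_le
  have h2 : (1 : ℝ) ≤ d.factorial := by exact_mod_cast d.factorial_pos
  have h3 : (1 : ℝ) ≤ max 1 ‖act A‖ := le_max_left _ _
  calc ‖act A‖ ≤ max 1 ‖act A‖ := le_max_right _ _
    _ ≤ max 1 ‖act A‖ ^ d := le_self_pow₀ h3 (NeZero.ne d)
    _ ≤ d * d * d.factorial * max 1 ‖act A‖ ^ d :=
        le_mul_of_one_le_left (by positivity) (one_le_mul_of_one_le_of_one_le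
          (one_le_mul_of_one_le_of_one_le h1 h1) h2)

theorem exists_expMoment [NeZero d] {K : Set (ProbabilityMeasure (SL d))} (hK : FiniteMoment K) :
    ∃ β M : ℝ, ExpMoment K β M := by
  obtain ⟨γ, C, hγ, hC⟩ := hK
  have hd : (0 : ℝ) < d := by exact_mod_cast NeZero.pos d
  set D : ℝ := d * d * d.factorial with hD
  have hD0 : 0 ≤ D := by positivity
  -- `size A` is at most `D * max 1 ‖A‖ ^ d`, so the exponent `γ / d` brings back exactly the
  -- assumed moment of order `γ`.
  set β := γ / d with hβ
  have hβ0 : 0 < β := by positivity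
  have key : ∀ A : SL d, Real.exp (β * height A) ≤ D ^ β * (1 + ‖act A‖ ^ γ) := by
    intro A
    have h0 : (0 : ℝ) ≤ max 1 ‖act A‖ := by positivity
    rw [height, mul_comm, ← Real.rpow_def_of_pos (size_pos A)]
    calc size A ^ β ≤ (D * max 1 ‖act A‖ ^ d) ^ β :=
          Real.rpow_le_rpow (size_pos A).le (size_le A) hβ0.le
      _ = D ^ β * max 1 ‖act A‖ ^ γ := by
          rw [Real.mul_rpow hD0 (by positivity), ← Real.rpow_natCast_mul h0, hβ,
            mul_div_cancel₀ _ hd.ne']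
      _ ≤ D ^ β * (1 + ‖act A‖ ^ γ) := by
          gcongr
          rcases max_cases 1 ‖act A‖ with ⟨h, -⟩ | ⟨h, -⟩ <;> rw [h]
          · rw [Real.one_rpow]; linarith [Real.rpow_nonneg (norm_nonneg (act A)) γ]
          · linarith
  refine ⟨β, max 1 (D ^ β * (1 + max C 0)), hβ0, le_max_left _ _, fun μ hμ => ?_⟩
  have hme : Measurable fun A : SL d => ENNReal.ofReal (‖act A‖ ^ γ) :=
    (continuous_act.norm.measurable.pow_const γ).ennreal_ofReal
  calc ∫⁻ A, ENNReal.ofReal (Real.exp (β * height A)) ∂(μ : Measure (SL d))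
      ≤ ∫⁻ A, ENNReal.ofReal (D ^ β) * (1 + ENNReal.ofReal (‖act A‖ ^ γ)) ∂(μ : Measure (SL d)) := by
        refine lintegral_mono fun A => ?_
        rw [← ENNReal.ofReal_one, ← ENNReal.ofReal_add zero_le_one (by positivity),
          ← ENNReal.ofReal_mul (by positivity)]
        exact ENNReal.ofReal_le_ofReal (key A)
    _ = ENNReal.ofReal (D ^ β) * (1 + ∫⁻ A, ENNReal.ofReal (‖act A‖ ^ γ) ∂(μ : Measure (SL d))) := by
        rw [lintegral_const_mul _ (by fun_prop), lintegral_add_left measurable_const]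
        simp
    _ ≤ ENNReal.ofReal (D ^ β) * (1 + ENNReal.ofReal (max C 0)) := by
        gcongr
        exact (hC μ hμ).le.trans (ENNReal.ofReal_le_ofReal (le_max_left _ _))
    _ = ENNReal.ofReal (D ^ β * (1 + max C 0)) := by
        rw [ENNReal.ofReal_mul (by positivity), ENNReal.ofReal_add zero_le_one (by positivity),
          ENNReal.ofReal_one]
    _ ≤ _ := ENNReal.ofReal_le_ofReal (le_max_right _ _)

theorem measurable_log_norm_act : Measurable fun A : SL d => Real.log ‖act A‖ :=
  continuous_act.norm.measurable.log

theorem measurable_norm_act_apply (v : E d) : Measurable fun A : SL d => ‖act A v‖ :=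
  ((continuous_act.clm_apply continuous_const).norm).measurable

theorem L_eq (μ : ℕ → ProbabilityMeasure (SL d)) (n : ℕ) :
    L μ n = ∫ A, Real.log ‖act A‖ ∂conv μ n := by
  rw [← map_prodT_law, integral_map (continuous_prodT n).measurable.aemeasurable
    measurable_log_norm_act.aestronglyMeasurable]
  rfl

section Moments

variable [NeZero d] {K : Set (ProbabilityMeasure (SL d))} {β M : ℝ}
  {μ : ℕ → ProbabilityMeasure (SL d)}

theorem measurable_height : Measurable (height : SL d → ℝ) := continuous_height.measurable

theorem ExpMoment.lintegral_conv_le (h : ExpMoment K β M) (hμ : ∀ i, μ i ∈ K) (n : ℕ) :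
    ∫⁻ A, ENNReal.ofReal (Real.exp (β * height A)) ∂conv μ n ≤ ENNReal.ofReal (M ^ n) := by
  have hm : Measurable fun A : SL d => ENNReal.ofReal (Real.exp (β * height A)) :=
    ((measurable_height.const_mul β).exp).ennreal_ofReal
  induction n with
  | zero =>
    have h1 : height (1 : SL d) = 0 := by simp [height, size, act_one]
    rw [conv, lintegral_dirac' _ hm, h1]; simp
  | succ n ih =>
    rw [conv, Measure.lintegral_mconv hm]
    calc _ ≤ ∫⁻ A, ∫⁻ B, ENNReal.ofReal (Real.exp (β * height A)) *
            ENNReal.ofReal (Real.exp (β * height B)) ∂conv μ n ∂(μ n : Measure (SL d)) := by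
          refine lintegral_mono fun A => lintegral_mono fun B => ?_
          rw [← ENNReal.ofReal_mul (by positivity), ← Real.exp_add, ← mul_add]
          refine ENNReal.ofReal_le_ofReal (Real.exp_le_exp.2 ?_)
          exact mul_le_mul_of_nonneg_left (height_mul_le A B) h.pos.le
      _ = (∫⁻ A, ENNReal.ofReal (Real.exp (β * height A)) ∂(μ n : Measure (SL d))) *
            ∫⁻ B, ENNReal.ofReal (Real.exp (β * height B)) ∂conv μ n := by
          simp_rw [lintegral_const_mul _ hm]
          rw [lintegral_mul_const _ hm]
      _ ≤ ENNReal.ofReal M * ENNReal.ofReal (M ^ n) :=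
          mul_le_mul' (h.lintegral_le _ (hμ n)) ih
      _ = _ := by rw [← ENNReal.ofReal_mul (zero_le_one.trans h.one_le), pow_succ']

theorem ExpMoment.integrable_exp (h : ExpMoment K β M) (hμ : ∀ i, μ i ∈ K) (n : ℕ) :
    Integrable (fun A => Real.exp (β * height A)) (conv μ n) := by
  refine ⟨(measurable_height.const_mul β).exp.aestronglyMeasurable, ?_⟩
  rw [hasFiniteIntegral_iff_ofReal (Eventually.of_forall fun A => by positivity)]
  exact (h.lintegral_conv_le hμ n).trans_lt ENNReal.ofReal_lt_top

theorem ExpMoment.integral_exp_le (h : ExpMoment K β M) (hμ : ∀ i, μ i ∈ K) (n : ℕ) :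
    ∫ A, Real.exp (β * height A) ∂conv μ n ≤ M ^ n := by
  have hM := zero_le_one.trans h.one_le
  rw [integral_eq_lintegral_of_nonneg_ae (Eventually.of_forall fun A => by positivity)
    (measurable_height.const_mul β).exp.aestronglyMeasurable]
  exact ENNReal.toReal_le_of_le_ofReal (by positivity) (h.lintegral_conv_le hμ n)

theorem ExpMoment.integrable_height (h : ExpMoment K β M) (hμ : ∀ i, μ i ∈ K) (n : ℕ) :
    Integrable height (conv μ n) := by
  refine ((h.integrable_exp hμ n).const_mul β⁻¹).mono' measurable_height.aestronglyMeasurable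
    (Eventually.of_forall fun A => ?_)
  rw [Real.norm_of_nonneg (height_nonneg A), ← div_eq_inv_mul, le_div_iff₀ h.pos, mul_comm]
  linarith [Real.add_one_le_exp (β * height A)]

theorem ExpMoment.lintegral_height_le (h : ExpMoment K β M) (hμ : ∀ i, μ i ∈ K) (n : ℕ) :
    ∫⁻ A, ENNReal.ofReal (height A) ∂conv μ n ≤ n * ENNReal.ofReal (M / β) := by
  have hm : Measurable fun A : SL d => ENNReal.ofReal (height A) :=
    measurable_height.ennreal_ofReal
  induction n with
  | zero =>
    have h1 : height (1 : SL d) = 0 := by simp [height, size, act_one]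
    rw [conv, lintegral_dirac' _ hm, h1]; simp
  | succ n ih =>
    rw [conv, Measure.lintegral_mconv hm]
    calc _ ≤ ∫⁻ A, ∫⁻ B, (ENNReal.ofReal (height A) + ENNReal.ofReal (height B))
            ∂conv μ n ∂(μ n : Measure (SL d)) := by
          refine lintegral_mono fun A => lintegral_mono fun B => ?_
          rw [← ENNReal.ofReal_add (height_nonneg A) (height_nonneg B)]
          exact ENNReal.ofReal_le_ofReal (height_mul_le A B)
      _ = (∫⁻ A, ENNReal.ofReal (height A) ∂(μ n : Measure (SL d))) +
            ∫⁻ B, ENNReal.ofReal (height B) ∂conv μ n := by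
          simp_rw [lintegral_add_left measurable_const]
          rw [lintegral_add_right _ measurable_const]
          simp
      _ ≤ ENNReal.ofReal (M / β) + n * ENNReal.ofReal (M / β) := by
          refine add_le_add ?_ ih
          calc _ ≤ ∫⁻ A, ENNReal.ofReal β⁻¹ * ENNReal.ofReal (Real.exp (β * height A))
                  ∂(μ n : Measure (SL d)) := by
                refine lintegral_mono fun A => ?_
                rw [← ENNReal.ofReal_mul (inv_nonneg.2 h.pos.le)]
                refine ENNReal.ofReal_le_ofReal ?_
                rw [← div_eq_inv_mul, le_div_iff₀ h.pos, mul_comm]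
                linarith [Real.add_one_le_exp (β * height A)]
            _ ≤ ENNReal.ofReal β⁻¹ * ENNReal.ofReal M := by
                rw [lintegral_const_mul _ ((measurable_height.const_mul β).exp).ennreal_ofReal]
                gcongr
                exact h.lintegral_le _ (hμ n)
            _ = _ := by rw [← ENNReal.ofReal_mul (inv_nonneg.2 h.pos.le), div_eq_inv_mul]
      _ = _ := by push_cast; ring

theorem ExpMoment.integral_height_le (h : ExpMoment K β M) (hμ : ∀ i, μ i ∈ K) (n : ℕ) :
    ∫ A, height A ∂conv μ n ≤ n * (M / β) := by
  have h0 : 0 ≤ M / β := div_nonneg (zero_le_one.trans h.one_le) h.pos.le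
  rw [integral_eq_lintegral_of_nonneg_ae (Eventually.of_forall height_nonneg)
    measurable_height.aestronglyMeasurable]
  refine ENNReal.toReal_le_of_le_ofReal (by positivity) ((h.lintegral_height_le hμ n).trans_eq ?_)
  rw [ENNReal.ofReal_mul (by positivity), ENNReal.ofReal_natCast]

theorem ExpMoment.integrable_log_norm (h : ExpMoment K β M) (hμ : ∀ i, μ i ∈ K) (n : ℕ) :
    Integrable (fun A => Real.log ‖act A‖) (conv μ n) :=
  (h.integrable_height hμ n).mono' measurable_log_norm_act.aestronglyMeasurable
    (Eventually.of_forall abs_log_norm_act_le)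

theorem ExpMoment.integrable_log_norm_apply (h : ExpMoment K β M) (hμ : ∀ i, μ i ∈ K) (n : ℕ)
    {v : E d} (hv : ‖v‖ = 1) :
    Integrable (fun A => Real.log ‖act A v‖) (conv μ n) :=
  (h.integrable_height hμ n).mono' (measurable_norm_act_apply v).log.aestronglyMeasurable
    (Eventually.of_forall fun A => abs_log_norm_act_apply_le A hv)

end Moments

/-! ### Semicontinuity of masses of closed sets -/

section Semicontinuity

variable {Ω Y : Type*} [TopologicalSpace Ω] [MeasurableSpace Ω] [TopologicalSpace Y]

theorem isClosed_setOf_le_measure [OpensMeasurableSpace Ω] [HasOuterApproxClosed Ω] {F : Set Ω}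
    (hF : IsClosed F) (c : ℝ≥0∞) :
    IsClosed {ρ : ProbabilityMeasure Ω | c ≤ (ρ : Measure Ω) F} := by
  refine isClosed_of_closure_subset fun ρ hρ => ?_
  set S := {ρ : ProbabilityMeasure Ω | c ≤ (ρ : Measure Ω) F}
  have : (𝓝[S] ρ).NeBot := mem_closure_iff_nhdsWithin_neBot.1 hρ
  have hlim : Tendsto id (𝓝[S] ρ) (𝓝 ρ) := tendsto_id.mono_left nhdsWithin_le_nhds
  calc c = limsup (fun _ : ProbabilityMeasure Ω => c) (𝓝[S] ρ) := limsup_const c |>.symm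
    _ ≤ limsup (fun ρ : ProbabilityMeasure Ω => (ρ : Measure Ω) F) (𝓝[S] ρ) :=
        limsup_le_limsup (eventually_mem_nhdsWithin)
    _ ≤ _ := ProbabilityMeasure.limsup_measure_closed_le_of_tendsto hlim hF

variable [SecondCountableTopology Ω] [TopologicalSpace.PseudoMetrizableSpace Ω] [BorelSpace Ω]
  [SecondCountableTopology Y] [TopologicalSpace.PseudoMetrizableSpace Y]

/-- The mass that a probability measure gives to the sections of a closed set is jointly upper
semicontinuous in the measure and in the section. -/
theorem isClosed_setOf_le_measure_section {F : Set (Ω × Y)} (hF : IsClosed F) (c : ℝ≥0∞) :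
    IsClosed {p : ProbabilityMeasure Ω × Y | c ≤ (p.1 : Measure Ω) {x | (x, p.2) ∈ F}} := by
  borelize Y
  -- The mass of the section at `y` is the mass of `F` under the product with the Dirac measure at
  -- `y`, which depends continuously on the pair.
  have hc : Continuous fun p : ProbabilityMeasure Ω × Y => p.1.prod (diracProba p.2) :=
    ProbabilityMeasure.continuous_prod.comp
      (continuous_fst.prodMk (continuous_diracProba.comp continuous_snd))
  have h := (isClosed_setOf_le_measure hF c).preimage hc
  convert h using 1
  ext p
  have h1 : ((p.1.prod (diracProba p.2) : ProbabilityMeasure (Ω × Y)) : Measure (Ω × Y)) F =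
      (p.1 : Measure Ω) {x | (x, p.2) ∈ F} := by
    rw [ProbabilityMeasure.toMeasure_prod]
    change ((p.1 : Measure Ω).prod (Measure.dirac p.2)) F = _
    rw [Measure.prod_dirac, Measure.map_apply measurable_prodMk_right hF.measurableSet]
    rfl
  simp only [mem_ofPred_eq, mem_preimage, h1]

end Semicontinuity

/-! ### Random directions and laws with an infinite past -/

/-- The unit sphere of `ℝ^d`. -/
abbrev Sph (d : ℕ) : Type := Metric.sphere (0 : E d) 1

theorem norm_sph (x : Sph d) : ‖(x : E d)‖ = 1 := mem_sphere_zero_iff_norm.1 x.2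

theorem sph_ne_zero (x : Sph d) : (x : E d) ≠ 0 := fun h => by simpa [h] using norm_sph x

/-- The normalized linear action on the unit sphere. -/
def sphereAct (p : SL d × Sph d) : Sph d :=
  ⟨‖act p.1 p.2‖⁻¹ • act p.1 p.2, by
    have h : 0 < ‖act p.1 p.2‖ := norm_pos_iff.2 (act_ne_zero p.1 (sph_ne_zero p.2))
    rw [mem_sphere_zero_iff_norm, norm_smul, norm_inv, norm_norm]
    exact inv_mul_cancel₀ h.ne'⟩

theorem coe_sphereAct (A : SL d) (x : Sph d) :
    (sphereAct (A, x) : E d) = ‖act A x‖⁻¹ • act A x := rfl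

theorem continuous_sphereAct : Continuous (sphereAct : SL d × Sph d → Sph d) := by
  have h : Continuous fun p : SL d × Sph d => act p.1 (p.2 : E d) :=
    (continuous_act.comp continuous_fst).clm_apply (continuous_subtype_val.comp continuous_snd)
  have hinv : Continuous fun p : SL d × Sph d => ‖act p.1 p.2‖⁻¹ :=
    h.norm.inv₀ fun p => (norm_pos_iff.2 (act_ne_zero p.1 (sph_ne_zero p.2))).ne'
  exact Continuous.subtype_mk (hinv.smul h) _

theorem sphereAct_mul (A B : SL d) (x : Sph d) :
    sphereAct (A * B, x) = sphereAct (A, sphereAct (B, x)) := by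
  have hB := norm_pos_iff.2 (act_ne_zero B (sph_ne_zero x))
  have hA := norm_pos_iff.2 (act_ne_zero A (act_ne_zero B (sph_ne_zero x)))
  ext1
  rw [coe_sphereAct, coe_sphereAct, coe_sphereAct, act_mul, map_smul, norm_smul, smul_smul,
    norm_inv, norm_norm, mul_inv, inv_inv, mul_comm ‖act B x‖, mul_assoc, mul_inv_cancel₀ hB.ne',
    mul_one]

/-- The law of the image of a random point under an independent random matrix. -/
def star (p : ProbabilityMeasure (SL d) × ProbabilityMeasure (Sph d)) :
    ProbabilityMeasure (Sph d) :=
  (p.1.prod p.2).map continuous_sphereAct.measurable.aemeasurable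

theorem continuous_star : Continuous (star (d := d)) :=
  (ProbabilityMeasure.continuous_map continuous_sphereAct).comp ProbabilityMeasure.continuous_prod

theorem coe_star (μ : ProbabilityMeasure (SL d)) (ν : ProbabilityMeasure (Sph d)) :
    (star (μ, ν) : Measure (Sph d)) =
      ((μ : Measure (SL d)).prod (ν : Measure (Sph d))).map sphereAct := rfl

/-- The laws on the sphere that can be reached in `k` steps. -/
def reach (K : Set (ProbabilityMeasure (SL d))) : ℕ → Set (ProbabilityMeasure (Sph d))
  | 0 => univ
  | k + 1 => star '' (K ×ˢ reach K k)

/-- The laws on the sphere that have an infinite past. -/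
def reachInf (K : Set (ProbabilityMeasure (SL d))) : Set (ProbabilityMeasure (Sph d)) :=
  ⋂ k, reach K k

section Reach

variable {K : Set (ProbabilityMeasure (SL d))}

theorem reach_succ_subset (k : ℕ) : reach K (k + 1) ⊆ reach K k := by
  induction k with
  | zero => exact subset_univ _
  | succ k ih => exact image_mono (prod_mono Subset.rfl ih)

theorem isCompact_reach (hK : IsCompact K) (k : ℕ) : IsCompact (reach K k) := by
  induction k with
  | zero => exact isCompact_univ
  | succ k ih => exact (hK.prod ih).image continuous_star

theorem isCompact_reachInf (hK : IsCompact K) : IsCompact (reachInf K) :=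
  (isCompact_reach hK 0).of_isClosed_subset
    (isClosed_iInter fun k => (isCompact_reach hK k).isClosed) (iInter_subset _ 0)

/-- The pairs in `K ×ˢ reach K k` that produce `ν` form nested nonempty compact sets, so some pair
works for all `k`. This backward step replaces the stationary measure of the classical theory. -/
theorem exists_star_eq (hK : IsCompact K) {ν : ProbabilityMeasure (Sph d)} (hν : ν ∈ reachInf K) :
    ∃ μ ∈ K, ∃ ν' ∈ reachInf K, star (μ, ν') = ν := by
  obtain ⟨p, hp⟩ := IsCompact.nonempty_iInter_of_sequence_nonempty_isCompact_isClosed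
    (fun k => (K ×ˢ reach K k) ∩ star ⁻¹' {ν})
    (fun k => inter_subset_inter_left _ (prod_mono Subset.rfl (reach_succ_subset k)))
    (fun k => by
      obtain ⟨p, hp, h⟩ := mem_iInter.1 hν (k + 1)
      exact ⟨p, hp, h⟩)
    ((hK.prod (isCompact_reach hK 0)).inter_right (isClosed_singleton.preimage continuous_star))
    (fun k => ((hK.prod (isCompact_reach hK k)).inter_right
      (isClosed_singleton.preimage continuous_star)).isClosed)
  rw [mem_iInter] at hp
  exact ⟨p.1, (hp 0).1.1, p.2, mem_iInter.2 fun k => (hp k).1.2, (hp 0).2⟩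

end Reach

/-! ### Masses of subspaces -/

/-- The trace of a subspace on the unit sphere. -/
def tr (W : Submodule ℝ (E d)) : Set (Sph d) := {x | (x : E d) ∈ W}

theorem isClosed_tr (W : Submodule ℝ (E d)) : IsClosed (tr W) :=
  W.closed_of_finiteDimensional.preimage continuous_subtype_val

/-- The preimage of a subspace under `act A`. -/
def pre (A : SL d) (W : Submodule ℝ (E d)) : Submodule ℝ (E d) :=
  W.map (act A⁻¹ : E d →ₗ[ℝ] E d)

theorem mem_pre {A : SL d} {W : Submodule ℝ (E d)} {x : E d} : x ∈ pre A W ↔ act A x ∈ W := by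
  constructor
  · rintro ⟨y, hy, rfl⟩
    change act A (act A⁻¹ y) ∈ W
    rwa [act_act_inv]
  · exact fun h => ⟨act A x, h, act_inv_act A x⟩

theorem finrank_pre (A : SL d) (W : Submodule ℝ (E d)) :
    Module.finrank ℝ (pre A W) = Module.finrank ℝ W :=
  (Submodule.equivMapOfInjective _ (act_injective A⁻¹) W).finrank_eq.symm

theorem pre_injective (A : SL d) : Function.Injective (pre A) :=
  Submodule.map_injective_of_injective (act_injective A⁻¹)

theorem sphereAct_mem_tr {A : SL d} {x : Sph d} {W : Submodule ℝ (E d)} :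
    sphereAct (A, x) ∈ tr W ↔ x ∈ tr (pre A W) := by
  have hA := norm_pos_iff.2 (act_ne_zero A (sph_ne_zero x))
  rw [tr, tr, mem_ofPred_eq, mem_ofPred_eq, mem_pre, coe_sphereAct,
    Submodule.smul_mem_iff _ (inv_ne_zero hA.ne')]

theorem star_tr (μ : ProbabilityMeasure (SL d)) (ν : ProbabilityMeasure (Sph d))
    (W : Submodule ℝ (E d)) :
    (star (μ, ν) : Measure (Sph d)) (tr W) =
      ∫⁻ A, (ν : Measure (Sph d)) (tr (pre A W)) ∂(μ : Measure (SL d)) := by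
  have hm := (isClosed_tr W).measurableSet
  rw [coe_star, Measure.map_apply continuous_sphereAct.measurable hm,
    Measure.prod_apply (continuous_sphereAct.measurable hm)]
  refine lintegral_congr fun A => ?_
  congr 1
  ext x
  exact sphereAct_mem_tr

theorem mem_orthogonal_span_range {ι : Type*} (n : ι → E d) (x : E d) :
    x ∈ (Submodule.span ℝ (range n))ᗮ ↔ ∀ i, inner ℝ (n i) x = 0 := by
  rw [Submodule.mem_orthogonal]
  refine ⟨fun h i => h _ (Submodule.subset_span (mem_range_self i)), fun h u hu => ?_⟩
  induction hu using Submodule.span_induction with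
  | mem y hy => obtain ⟨i, rfl⟩ := hy; exact h i
  | zero => simp
  | add y z _ _ hy hz => rw [inner_add_left, hy, hz, add_zero]
  | smul a y _ hy => rw [real_inner_smul_left, hy, mul_zero]

theorem isCompact_setOf_orthonormal (ι : Type*) [Fintype ι] :
    IsCompact {n : ι → E d | Orthonormal ℝ n} := by
  classical
  refine (isCompact_univ_pi fun _ : ι => isCompact_closedBall (0 : E d) 1).of_isClosed_subset ?_
    fun n hn i _ => by simpa using (hn.1 i).le
  simp only [orthonormal_iff_ite, ofPred_forall]
  exact isClosed_iInter fun i => isClosed_iInter fun j =>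
    isClosed_eq ((continuous_apply i).inner (continuous_apply j)) continuous_const

/-- Orthonormal frames of the complement parametrize the `j`-dimensional subspaces by a compact set,
which serves in place of the Grassmannian. -/
theorem exists_orthonormal_normals {j : ℕ} (W : Submodule ℝ (E d)) (hW : Module.finrank ℝ W = j) :
    ∃ n : Fin (d - j) → E d, Orthonormal ℝ n ∧ (Submodule.span ℝ (range n))ᗮ = W := by
  have h1 : Module.finrank ℝ Wᗮ = d - j := by
    have := Submodule.finrank_add_finrank_orthogonal W
    rw [finrank_euclideanSpace_fin, hW] at this
    omega
  let b := (stdOrthonormalBasis ℝ Wᗮ).reindex (finCongr h1)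
  refine ⟨fun i => (b i : E d), b.orthonormal.comp_linearIsometry Wᗮ.subtypeₗᵢ, ?_⟩
  have h2 : Submodule.span ℝ (range fun i => (b i : E d)) = Wᗮ := by
    have := congrArg (Submodule.map Wᗮ.subtype) b.toBasis.span_eq
    rw [Submodule.map_span, Submodule.map_top, Submodule.range_subtype, ← range_comp] at this
    have hb : (fun i => (b i : E d)) = Wᗮ.subtype ∘ b.toBasis := by
      ext1 i
      simp
    rw [hb, this]
  rw [h2, Submodule.orthogonal_orthogonal]

theorem finrank_orthogonal_span {j : ℕ} (hj : j ≤ d) {n : Fin (d - j) → E d}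
    (hn : Orthonormal ℝ n) : Module.finrank ℝ (Submodule.span ℝ (range n))ᗮ = j := by
  have h1 := Submodule.finrank_add_finrank_orthogonal (Submodule.span ℝ (range n))
  rw [finrank_euclideanSpace_fin, finrank_span_eq_card hn.linearIndependent, Fintype.card_fin] at h1
  omega

/-- Over a compact set of measures, some subspace of dimension `j` has maximal mass. -/
theorem exists_max_tr {N : Set (ProbabilityMeasure (Sph d))} (hN : IsCompact N)
    (hne : N.Nonempty) {j : ℕ} (hj : ∃ W : Submodule ℝ (E d), Module.finrank ℝ W = j) :
    ∃ ν₀ ∈ N, ∃ W₀ : Submodule ℝ (E d), Module.finrank ℝ W₀ = j ∧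
      ∀ ν ∈ N, ∀ W : Submodule ℝ (E d), Module.finrank ℝ W = j →
        (ν : Measure (Sph d)) (tr W) ≤ (ν₀ : Measure (Sph d)) (tr W₀) := by
  obtain ⟨ν₁, hν₁⟩ := hne
  obtain ⟨W₁, hW₁⟩ := hj
  obtain ⟨n₁, hn₁, -⟩ := exists_orthonormal_normals W₁ hW₁
  have hjd : j ≤ d := by
    rw [← hW₁]
    exact (Submodule.finrank_le W₁).trans_eq finrank_euclideanSpace_fin
  set F : Set (Sph d × (Fin (d - j) → E d)) := {p | ∀ i, inner ℝ (p.2 i) (p.1 : E d) = 0} with hFdef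
  have hF : IsClosed F := by
    simp only [hFdef, ofPred_forall]
    exact isClosed_iInter fun i => isClosed_eq
      (((continuous_apply i).comp continuous_snd).inner
        (continuous_subtype_val.comp continuous_fst)) continuous_const
  have htr : ∀ n : Fin (d - j) → E d, {x | (x, n) ∈ F} = tr (Submodule.span ℝ (range n))ᗮ := by
    intro n
    ext x
    exact (mem_orthogonal_span_range n x).symm
  set f : ProbabilityMeasure (Sph d) × (Fin (d - j) → E d) → ℝ≥0∞ :=
    fun p => (p.1 : Measure (Sph d)) {x | (x, p.2) ∈ F} with hf
  -- Incidence of a point with a frame is a closed relation, so the mass is upper semicontinuous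
  -- jointly in law and frame and attains its maximum on a compact set.
  have husc : UpperSemicontinuous f :=
    upperSemicontinuous_iff_isClosed_preimage.2 fun c => isClosed_setOf_le_measure_section hF c
  obtain ⟨⟨ν₀, n₀⟩, hmem, hmax⟩ := (husc.upperSemicontinuousOn _).exists_isMaxOn
    (s := N ×ˢ {n : Fin (d - j) → E d | Orthonormal ℝ n}) ⟨(ν₁, n₁), hν₁, hn₁⟩
    (hN.prod (isCompact_setOf_orthonormal _))
  refine ⟨ν₀, hmem.1, (Submodule.span ℝ (range n₀))ᗮ, finrank_orthogonal_span hjd hmem.2, ?_⟩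
  intro ν hν W hW
  obtain ⟨n, hn, rfl⟩ := exists_orthonormal_normals W hW
  have := hmax (show (ν, n) ∈ _ from ⟨hν, hn⟩)
  simpa only [hf, htr, mem_ofPred_eq] using this

/-- Subspaces that meet in null sets and have mass `m` each number at most `1 / m`. -/
theorem card_mul_le_one {ν : ProbabilityMeasure (Sph d)} {j : ℕ}
    (hlow : ∀ W : Submodule ℝ (E d), Module.finrank ℝ W < j → (ν : Measure (Sph d)) (tr W) = 0)
    {m : ℝ≥0∞} (S : Finset (Submodule ℝ (E d)))
    (hS : ∀ W ∈ S, Module.finrank ℝ W = j ∧ (ν : Measure (Sph d)) (tr W) = m) :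
    S.card * m ≤ 1 := by
  have hdisj : Set.Pairwise (S : Set (Submodule ℝ (E d)))
      (Function.onFun (AEDisjoint (ν : Measure (Sph d))) tr) := by
    intro W hW W' hW' hne
    have h1 : tr W ∩ tr W' = tr (W ⊓ W') := rfl
    change (ν : Measure (Sph d)) (tr W ∩ tr W') = 0
    rw [h1]
    refine hlow _ ?_
    rw [← (hS W hW).1]
    refine Submodule.finrank_lt_finrank_of_lt (lt_of_le_of_ne inf_le_left fun h => hne ?_)
    exact Submodule.eq_of_le_of_finrank_eq (inf_eq_left.1 h) ((hS W hW).1.trans (hS W' hW').1.symm)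
  have h2 := measure_biUnion_finset₀ hdisj fun W _ => (isClosed_tr W).measurableSet.nullMeasurableSet
  rw [Finset.sum_congr rfl fun W hW => (hS W hW).2, Finset.sum_const, nsmul_eq_mul] at h2
  rw [← h2]
  exact prob_le_one

/-- Laws with an infinite past give no mass to proper subspaces. -/
theorem measure_tr_eq_zero {K : Set (ProbabilityMeasure (SL d))} (hK : IsCompact K)
    (hspaces : SpacesCondition K) {ν : ProbabilityMeasure (Sph d)} (hν : ν ∈ reachInf K)
    {W : Submodule ℝ (E d)} (hW : W ≠ ⊤) : (ν : Measure (Sph d)) (tr W) = 0 := by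
  classical
  by_contra hpos
  have hex : ∃ j, ∃ ν ∈ reachInf K, ∃ W : Submodule ℝ (E d), Module.finrank ℝ W = j ∧
      (ν : Measure (Sph d)) (tr W) ≠ 0 := ⟨_, ν, hν, W, rfl, hpos⟩
  -- Minimality of `j` makes distinct `j`-dimensional subspaces almost disjoint for every law with
  -- an infinite past.
  set j := Nat.find hex with hjdef
  have hjlt : j < d := by
    refine (Nat.find_min' hex ⟨ν, hν, W, rfl, hpos⟩).trans_lt ?_
    exact (Submodule.finrank_lt hW).trans_eq finrank_euclideanSpace_fin
  have hlow : ∀ ν ∈ reachInf K, ∀ W : Submodule ℝ (E d), Module.finrank ℝ W < j →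
      (ν : Measure (Sph d)) (tr W) = 0 := by
    intro ν hν W hW
    by_contra h
    exact Nat.find_min hex hW ⟨ν, hν, W, rfl, h⟩
  obtain ⟨ν₁, hν₁, W₁, hW₁, hpos₁⟩ := Nat.find_spec hex
  obtain ⟨ν₀, hν₀, W₀, hW₀, hmax⟩ := exists_max_tr (isCompact_reachInf hK) ⟨ν, hν⟩ ⟨W₁, hW₁⟩
  set m := (ν₀ : Measure (Sph d)) (tr W₀) with hm
  have hm0 : m ≠ 0 := fun h => hpos₁ (le_antisymm (h ▸ hmax ν₁ hν₁ W₁ hW₁) zero_le)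
  set X : ProbabilityMeasure (Sph d) → Set (Submodule ℝ (E d)) :=
    fun ν => {W | Module.finrank ℝ W = j ∧ (ν : Measure (Sph d)) (tr W) = m} with hX
  obtain ⟨b, hb⟩ := ENNReal.exists_nat_mul_gt hm0 (ENNReal.one_ne_top)
  have hcard : ∀ ν ∈ reachInf K, ∀ S : Finset (Submodule ℝ (E d)), (S : Set _) ⊆ X ν →
      S.card < b := by
    intro ν hν S hS
    have h1 := card_mul_le_one (hlow ν hν) S fun W hW => hS hW
    by_contra! h
    exact absurd (hb.trans_le (mul_le_mul_left (Nat.cast_le.2 h) m)) h1.not_gt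
  have hfin : ∀ ν ∈ reachInf K, (X ν).Finite := by
    intro ν hν
    by_contra h
    obtain ⟨S, hS, hSc⟩ := Set.Infinite.exists_subset_card_eq h b
    exact absurd (hcard ν hν S hS) (by rw [hSc]; exact lt_irrefl b)
  have hbdd : BddAbove ((fun ν => (X ν).ncard) '' reachInf K) := by
    refine ⟨b, ?_⟩
    rintro _ ⟨ν, hν, rfl⟩
    change (X ν).ncard ≤ b
    rw [Set.ncard_eq_toFinset_card _ (hfin ν hν)]
    exact (hcard ν hν _ (by simp)).le
  -- Take a law with the largest number of subspaces of mass `m`; this number is bounded because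
  -- their masses add up to at most one.
  obtain ⟨ν₂, hν₂, hν₂max⟩ := Nat.sSup_mem (Set.Nonempty.image _ ⟨ν, hν⟩) hbdd
  have hle : ∀ ν ∈ reachInf K, (X ν).ncard ≤ (X ν₂).ncard := fun ν hν =>
    (le_csSup hbdd ⟨ν, hν, rfl⟩).trans_eq hν₂max.symm
  have hne₂ : (X ν₂).Nonempty := by
    rw [← Set.ncard_pos (hfin ν₂ hν₂)]
    refine lt_of_lt_of_le ?_ (hle ν₀ hν₀)
    rw [Set.ncard_pos (hfin ν₀ hν₀)]
    exact ⟨W₀, hW₀, rfl⟩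
  obtain ⟨μ, hμ, ν₃, hν₃, hstar⟩ := exists_star_eq hK hν₂
  have hae : ∀ᵐ A ∂(μ : Measure (SL d)), ∀ W ∈ X ν₂, pre A W ∈ X ν₃ := by
    refine (ae_ball_iff (hfin ν₂ hν₂).countable).2 fun W hW => ?_
    have h1 := hW.2
    rw [← hstar, star_tr] at h1
    have hle' : ∀ A, (ν₃ : Measure (Sph d)) (tr (pre A W)) ≤ m := fun A =>
      hmax ν₃ hν₃ _ ((finrank_pre A W).trans hW.1)
    -- The masses of the preimages average to `m` and none exceeds `m`, so almost all equal `m`.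
    have h2 := ae_eq_of_ae_le_of_lintegral_le (μ := (μ : Measure (SL d)))
      (f := fun A => (ν₃ : Measure (Sph d)) (tr (pre A W))) (g := fun _ => m)
      (Eventually.of_forall hle') (by rw [h1]; exact measure_ne_top _ _) aemeasurable_const
      (by rw [h1]; simp)
    filter_upwards [h2] with A hA
    exact ⟨(finrank_pre A W).trans hW.1, hA⟩
  have himage : ∀ᵐ A ∂(μ : Measure (SL d)), pre A '' X ν₂ = X ν₃ := by
    filter_upwards [hae] with A hA
    -- Taking preimages is injective and `X ν₃` has no more elements than `X ν₂`, so the inclusion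
    -- is an equality.
    refine Set.eq_of_subset_of_ncard_le (image_subset_iff.2 hA) ?_ (hfin ν₃ hν₃)
    rw [Set.ncard_image_of_injective _ (pre_injective A)]
    exact hle ν₃ hν₃
  have hunion : ∀ ν ∈ reachInf K, (X ν).Nonempty →
      IsFiniteUnionOfProperSubspaces (⋃ W ∈ X ν, (W : Set (E d))) := by
    intro ν hν hne
    refine ⟨(hfin ν hν).toFinset, by simpa using hne, fun W hW => ?_, by simp⟩
    rw [Set.Finite.mem_toFinset] at hW
    constructor
    · rintro rfl
      refine hm0 (hW.2.symm.trans ?_)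
      have : tr (⊥ : Submodule ℝ (E d)) = ∅ :=
        eq_empty_of_forall_notMem fun x hx => sph_ne_zero x ((Submodule.mem_bot ℝ).1 hx)
      rw [this, measure_empty]
    · rintro rfl
      have := hW.1
      rw [finrank_top, finrank_euclideanSpace_fin] at this
      omega
  obtain ⟨A₀, hA₀⟩ := himage.exists
  refine hspaces μ hμ ⟨_, _, hunion ν₃ hν₃ (hA₀ ▸ hne₂.image _), hunion ν₂ hν₂ hne₂, ?_⟩
  filter_upwards [himage] with A hA
  rw [← hA]
  ext y
  simp only [mem_image, mem_iUnion, exists_prop, SetLike.mem_coe]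
  constructor
  · rintro ⟨x, ⟨_, ⟨W, hW, rfl⟩, hx⟩, rfl⟩
    exact ⟨W, hW, mem_pre.1 hx⟩
  · rintro ⟨W, hW, hy⟩
    refine ⟨act A⁻¹ y, ⟨pre A W, ⟨W, hW, rfl⟩, ?_⟩, act_act_inv A y⟩
    rwa [mem_pre, act_act_inv]

/-! ### Uniform non-concentration near hyperplanes -/

/-- Otherwise the bad pairs `(ν, w)`, with `ν` in `reach K k` and strip width `1 / (k + 1)`, form
nested nonempty compact sets. A common pair is a law with an infinite past that gives mass at least
`δ` to every strip, hence to the hyperplane orthogonal to `w`. -/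
theorem exists_reach_measure_lt {K : Set (ProbabilityMeasure (SL d))} (hK : IsCompact K)
    (hspaces : SpacesCondition K) {δ : ℝ≥0∞} (hδ : δ ≠ 0) :
    ∃ k : ℕ, ∃ c : ℝ, 0 < c ∧ ∀ ν ∈ reach K k, ∀ w : Sph d,
      (ν : Measure (Sph d)) {x | |inner ℝ (w : E d) x| ≤ c} < δ := by
  by_contra! hcon
  set F : ℕ → Set (Sph d × Sph d) :=
    fun k => {p | |inner ℝ (p.2 : E d) p.1| ≤ 1 / ((k : ℝ) + 1)} with hFdef
  have hF : ∀ k, IsClosed (F k) := fun k => isClosed_le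
    (((continuous_subtype_val.comp continuous_snd).inner
      (continuous_subtype_val.comp continuous_fst)).abs) continuous_const
  have hFmono : ∀ k, F (k + 1) ⊆ F k := fun k p hp =>
    le_trans (show |inner ℝ (p.2 : E d) p.1| ≤ _ from hp) (Nat.one_div_le_one_div k.le_succ)
  set D : ℕ → Set (ProbabilityMeasure (Sph d) × Sph d) := fun k =>
    (reach K k ×ˢ univ) ∩ {p | δ ≤ (p.1 : Measure (Sph d)) {x | (x, p.2) ∈ F k}} with hD
  have hDclosed : ∀ k, IsClosed (D k) := fun k =>
    ((isCompact_reach hK k).isClosed.prod isClosed_univ).inter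
      (isClosed_setOf_le_measure_section (hF k) δ)
  obtain ⟨⟨ν, w⟩, hp⟩ := IsCompact.nonempty_iInter_of_sequence_nonempty_isCompact_isClosed D
    (fun k => inter_subset_inter (prod_mono (reach_succ_subset k) Subset.rfl)
      fun p (hp : δ ≤ _) => hp.trans (measure_mono fun x hx => hFmono k hx))
    (fun k => by
      obtain ⟨ν, hν, w, hw⟩ := hcon k (1 / ((k : ℝ) + 1)) (by positivity)
      exact ⟨(ν, w), ⟨hν, mem_univ _⟩, hw⟩)
    (((isCompact_reach hK 0).prod isCompact_univ).of_isClosed_subset (hDclosed 0)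
      inter_subset_left) hDclosed
  rw [mem_iInter] at hp
  have hν : ν ∈ reachInf K := mem_iInter.2 fun k => (hp k).1.1
  have hW : (Submodule.span ℝ {(w : E d)})ᗮ ≠ ⊤ := by
    rw [Ne, Submodule.orthogonal_eq_top_iff, Submodule.span_singleton_eq_bot]
    exact sph_ne_zero w
  have hzero := measure_tr_eq_zero hK hspaces hν hW
  have hanti : Antitone fun k => {x | (x, w) ∈ F k} :=
    antitone_nat_of_succ_le fun k x hx => hFmono k hx
  have hinter : ⋂ k, {x | (x, w) ∈ F k} = tr (Submodule.span ℝ {(w : E d)})ᗮ := by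
    ext x
    simp only [mem_iInter, hFdef, mem_ofPred_eq, tr, Submodule.mem_orthogonal_singleton_iff_inner_right]
    constructor
    · intro h
      refine abs_nonpos_iff.1 (ge_of_tendsto' tendsto_one_div_add_atTop_nhds_zero_nat h)
    · intro h k
      rw [h, abs_zero]; positivity
  have hlim := tendsto_measure_iInter_atTop (μ := (ν : Measure (Sph d)))
    (fun k => ((hF k).preimage (Continuous.prodMk_left w)).measurableSet.nullMeasurableSet) hanti
    ⟨0, measure_ne_top _ _⟩
  rw [show ⋂ k, (fun x => (x, w)) ⁻¹' F k = tr (Submodule.span ℝ {(w : E d)})ᗮ from hinter,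
    hzero] at hlim
  exact hδ (le_antisymm (ge_of_tendsto' hlim fun k => (hp k).2) zero_le)

/-- The law of the direction of `T_k x`. -/
def orbitLaw (μ : ℕ → ProbabilityMeasure (SL d)) (k : ℕ) (x : Sph d) : ProbabilityMeasure (Sph d) :=
  ProbabilityMeasure.map (⟨conv μ k, inferInstance⟩ : ProbabilityMeasure (SL d))
    (f := fun A => sphereAct (A, x))
    (continuous_sphereAct.comp (Continuous.prodMk_left x)).measurable.aemeasurable

theorem orbitLaw_mem_reach {K : Set (ProbabilityMeasure (SL d))}
    {μ : ℕ → ProbabilityMeasure (SL d)} (hμ : ∀ i, μ i ∈ K) (x : Sph d) (k : ℕ) :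
    orbitLaw μ k x ∈ reach K k := by
  have hmeas : Measurable fun A : SL d => sphereAct (A, x) :=
    (continuous_sphereAct.comp (Continuous.prodMk_left x)).measurable
  induction k with
  | zero => exact mem_univ _
  | succ k ih =>
    refine ⟨(μ k, orbitLaw μ k x), ⟨hμ k, ih⟩, ?_⟩
    apply Subtype.ext
    change ((μ k : Measure (SL d)).prod ((conv μ k).map fun A => sphereAct (A, x))).map sphereAct =
      (((μ k : Measure (SL d)).prod (conv μ k)).map fun p => p.1 * p.2).map
        fun A => sphereAct (A, x)
    rw [Measure.map_map hmeas measurable_mul]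
    nth_rewrite 1 [← Measure.map_id (μ := (μ k : Measure (SL d)))]
    rw [Measure.map_prod_map _ _ measurable_id hmeas, Measure.map_map
      continuous_sphereAct.measurable (measurable_id.prodMap hmeas)]
    congr 1
    ext1 p
    exact (sphereAct_mul p.1 p.2 x).symm

/-- After a fixed number of steps the direction of `T_k v` is rarely close to any given
hyperplane, uniformly over all sequences of laws from `K`. -/
theorem exists_conv_near_hyperplane_lt {K : Set (ProbabilityMeasure (SL d))} (hK : IsCompact K)
    (hspaces : SpacesCondition K) {δ : ℝ} (hδ : 0 < δ) :
    ∃ k : ℕ, ∃ c : ℝ, 0 < c ∧ ∀ μ : ℕ → ProbabilityMeasure (SL d), (∀ i, μ i ∈ K) →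
      ∀ v w : E d, ‖v‖ = 1 → ‖w‖ = 1 →
        (conv μ k).real {A | |inner ℝ w (act A v)| ≤ c * ‖act A v‖} ≤ δ := by
  obtain ⟨k, c, hc, h⟩ := exists_reach_measure_lt hK hspaces (ENNReal.ofReal_pos.2 hδ).ne'
  refine ⟨k, c, hc, fun μ hμ v w hv hw => ?_⟩
  let x : Sph d := ⟨v, by simpa using hv⟩
  let y : Sph d := ⟨w, by simpa using hw⟩
  have h1 := h _ (orbitLaw_mem_reach hμ x k) y
  have hclosed : IsClosed {z : Sph d | |inner ℝ (y : E d) z| ≤ c} :=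
    isClosed_le ((continuous_const.inner continuous_subtype_val).abs) continuous_const
  change ((conv μ k).map fun A => sphereAct (A, x)) _ < _ at h1
  have hmeas : Measurable fun A : SL d => sphereAct (A, x) :=
    (continuous_sphereAct.comp (Continuous.prodMk_left x)).measurable
  rw [Measure.map_apply hmeas hclosed.measurableSet] at h1
  refine ENNReal.toReal_le_of_le_ofReal hδ.le (le_of_eq_of_le ?_ h1.le)
  congr 1
  ext A
  have hA : 0 < ‖act A v‖ := norm_pos_iff.2 (act_ne_zero A (sph_ne_zero x))
  have hinner : inner ℝ (y : E d) (sphereAct (A, x) : E d) = ‖act A v‖⁻¹ * inner ℝ w (act A v) := by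
    rw [coe_sphereAct, real_inner_smul_right]
  rw [mem_preimage, mem_ofPred_eq, mem_ofPred_eq, hinner, abs_mul, abs_of_pos (inv_pos.2 hA),
    inv_mul_le_iff₀ hA, mul_comm c]

/-! ### Mean growth of vectors and of the norm -/

section Growth

variable [NeZero d] {K : Set (ProbabilityMeasure (SL d))} {β M : ℝ}

/-- The expected growth of a fixed unit vector is almost the expected growth of the norm. -/
theorem ExpMoment.exists_L_sub_integral_le (h : ExpMoment K β M) (hK : IsCompact K)
    (hspaces : SpacesCondition K) {ε : ℝ} (hε : 0 < ε) :
    ∃ m : ℕ, ∀ n, m ≤ n → ∀ μ : ℕ → ProbabilityMeasure (SL d), (∀ i, μ i ∈ K) →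
      ∀ v : E d, ‖v‖ = 1 → L μ n - ∫ A, Real.log ‖act A v‖ ∂conv μ n ≤ ε * n := by
  set C := M / β with hC
  have hC0 : 0 < C := div_pos (one_pos.trans_le h.one_le) h.pos
  -- The bad event costs at most `2 * height B`, of mean at most `2 * r * C`; this probability
  -- reduces the loss to `ε * r / 2`. The threshold `m₀` absorbs the remaining constant in another
  -- `ε * n / 2`.
  have hδ : 0 < ε / (4 * C) := by positivity
  obtain ⟨k, c, hc, hkc⟩ := exists_conv_near_hyperplane_lt hK hspaces hδ
  obtain ⟨m₀, hm₀⟩ := exists_nat_ge ((2 * (k * C) + |Real.log c|) * 2 / ε)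
  refine ⟨max k m₀, fun n hn μ hμ v hv => ?_⟩
  obtain ⟨r, rfl⟩ := Nat.exists_eq_add_of_le ((le_max_left _ _).trans hn)
  set μ' : ℕ → ProbabilityMeasure (SL d) := fun i => μ (k + i) with hμ'
  have hμ'K : ∀ i, μ' i ∈ K := fun i => hμ _
  set g : SL d → ℝ := fun A => Real.log ‖act A‖ - Real.log ‖act A v‖ with hg
  have hg0 : ∀ A, 0 ≤ g A := fun A => sub_nonneg.2 (log_norm_act_apply_le hv)
  have hgint : Integrable g (conv μ (k + r)) :=
    (h.integrable_log_norm hμ _).sub (h.integrable_log_norm_apply hμ _ hv)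
  have hinner : ∀ B : SL d, ∫ T, g (B * T) ∂conv μ k ≤
      2 * (k * C) + |Real.log c| + 2 * height B * (ε / (4 * C)) := by
    intro B
    obtain ⟨w, hw, hBw⟩ := exists_unit_norm_mul_inner_le B
    set S : Set (SL d) := {A | |inner ℝ w (act A v)| ≤ c * ‖act A v‖} with hS
    have hSm : MeasurableSet S := by
      have hcont : Continuous fun A : SL d => act A v :=
        continuous_act.clm_apply continuous_const
      exact (isClosed_le (continuous_const.inner hcont).abs
        (continuous_const.mul hcont.norm)).measurableSet
    -- On `S` only the trivial bound by heights is available. Off `S`, `|B T v| ≥ ‖B‖ c |T v|`, so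
    -- `log ‖B‖` cancels and the long factor `B` contributes nothing.
    have hpt : ∀ T, g (B * T) ≤ 2 * height T + |Real.log c| +
        S.indicator (fun _ => 2 * height B) T := by
      intro T
      have h1 := log_norm_act_mul_le B T
      have h2 := (abs_le.1 (abs_log_norm_act_le B)).2
      have h3 := (abs_le.1 (abs_log_norm_act_le T)).2
      by_cases hT : T ∈ S
      · rw [indicator_of_mem hT]
        have h4 := (abs_le.1 (abs_log_norm_act_apply_le (B * T) hv)).1
        have h5 := height_mul_le B T
        have h6 := abs_nonneg (Real.log c)
        simp only [hg]
        linarith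
      · rw [indicator_of_notMem hT]
        have hT' : c * ‖act T v‖ < |inner ℝ w (act T v)| := not_le.1 hT
        have hv0 : v ≠ 0 := by rintro rfl; simp at hv
        have hTv : 0 < ‖act T v‖ := norm_pos_iff.2 (act_ne_zero T hv0)
        have hB := norm_act_pos B
        have h4 : ‖act B‖ * (c * ‖act T v‖) ≤ ‖act (B * T) v‖ := by
          rw [act_mul]
          exact (mul_le_mul_of_nonneg_left hT'.le hB.le).trans (hBw _)
        have h5 := Real.log_le_log (by positivity) h4
        rw [Real.log_mul hB.ne' (by positivity), Real.log_mul hc.ne' hTv.ne'] at h5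
        have h6 := (abs_le.1 (abs_log_norm_act_apply_le T hv)).1
        have h7 := neg_abs_le (Real.log c)
        simp only [hg]
        linarith
    have hi1 : Integrable (fun T => 2 * height T + |Real.log c|) (conv μ k) :=
      ((h.integrable_height hμ k).const_mul 2).add (integrable_const _)
    have hi2 : Integrable (S.indicator fun _ => 2 * height B) (conv μ k) :=
      (integrable_const _).indicator hSm
    calc ∫ T, g (B * T) ∂conv μ k
        ≤ ∫ T, (2 * height T + |Real.log c| + S.indicator (fun _ => 2 * height B) T) ∂conv μ k :=
          integral_mono_of_nonneg (Eventually.of_forall fun T => hg0 _) (hi1.add hi2)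
            (Eventually.of_forall hpt)
      _ = 2 * ∫ T, height T ∂conv μ k + |Real.log c| + (conv μ k).real S * (2 * height B) := by
          rw [integral_add hi1 hi2, integral_add ((h.integrable_height hμ k).const_mul 2)
            (integrable_const _), integral_const_mul, integral_const, integral_indicator hSm,
            setIntegral_const]
          simp
      _ ≤ 2 * (k * C) + |Real.log c| + ε / (4 * C) * (2 * height B) := by
          have := height_nonneg B
          gcongr
          · exact h.integral_height_le hμ k
          · exact hkc μ hμ v w hv hw
      _ = _ := by ring
  have hmain : ∫ A, g A ∂conv μ (k + r) ≤
      2 * (k * C) + |Real.log c| + 2 * (r * C) * (ε / (4 * C)) := by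
    rw [conv_add] at hgint ⊢
    rw [integral_mconv hgint]
    have hi : Integrable (fun B => 2 * height B * (ε / (4 * C))) (conv μ' r) :=
      ((h.integrable_height hμ'K r).const_mul 2).mul_const _
    calc _ ≤ ∫ B, (2 * (k * C) + |Real.log c| + 2 * height B * (ε / (4 * C))) ∂conv μ' r :=
          integral_mono_of_nonneg
            (Eventually.of_forall fun B => integral_nonneg fun T => hg0 _)
            ((integrable_const _).add hi) (Eventually.of_forall hinner)
      _ = 2 * (k * C) + |Real.log c| + 2 * (∫ B, height B ∂conv μ' r) * (ε / (4 * C)) := by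
          rw [integral_add (integrable_const _) hi, integral_mul_const, integral_const_mul,
            integral_const]
          simp
      _ ≤ _ := by
          gcongr
          exact h.integral_height_le hμ'K r
  rw [L_eq, ← integral_sub (h.integrable_log_norm hμ _) (h.integrable_log_norm_apply hμ _ hv)]
  refine hmain.trans ?_
  have h1 : 2 * (r * C) * (ε / (4 * C)) = ε * r / 2 := by field_simp; ring
  have h2 : (2 * (k * C) + |Real.log c|) * 2 / ε ≤ ((k + r : ℕ) : ℝ) :=
    hm₀.trans (Nat.cast_le.2 ((le_max_right _ _).trans hn))
  rw [div_le_iff₀ hε] at h2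
  have h3 : 0 ≤ ε * (k : ℝ) := by positivity
  rw [h1]
  push_cast at h2 ⊢
  linarith

theorem ExpMoment.integral_le_L (h : ExpMoment K β M) {μ : ℕ → ProbabilityMeasure (SL d)}
    (hμ : ∀ i, μ i ∈ K) (n : ℕ) {v : E d} (hv : ‖v‖ = 1) :
    ∫ A, Real.log ‖act A v‖ ∂conv μ n ≤ L μ n := by
  rw [L_eq]
  exact integral_mono (h.integrable_log_norm_apply hμ n hv) (h.integrable_log_norm hμ n)
    fun A => log_norm_act_apply_le hv

theorem ExpMoment.abs_L_le (h : ExpMoment K β M) {μ : ℕ → ProbabilityMeasure (SL d)}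
    (hμ : ∀ i, μ i ∈ K) (n : ℕ) : |L μ n| ≤ n * (M / β) := by
  rw [L_eq]
  exact (abs_integral_le_integral_abs).trans ((integral_mono (h.integrable_log_norm hμ n).abs
    (h.integrable_height hμ n) abs_log_norm_act_le).trans (h.integral_height_le hμ n))

end Growth

/-! ### Exponential moments over blocks -/

theorem exp_le_one_add_add_sq_mul_exp_abs (x : ℝ) :
    Real.exp x ≤ 1 + x + x ^ 2 * Real.exp |x| := by
  have h := Complex.norm_exp_sub_sum_le_norm_mul_exp (x : ℂ) 2
  have h1 : Complex.exp x - ∑ m ∈ Finset.range 2, (x : ℂ) ^ m / (m.factorial : ℂ) =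
      ((Real.exp x - (1 + x) : ℝ) : ℂ) := by
    simp [Finset.sum_range_succ]
  rw [h1, Complex.norm_real, Complex.norm_real, Real.norm_eq_abs, Real.norm_eq_abs, sq_abs] at h
  linarith [le_abs_self (Real.exp x - (1 + x))]

section Blocks

variable [NeZero d] {K : Set (ProbabilityMeasure (SL d))} {β M : ℝ}

/-- Exponential moments of the centred logarithm, uniformly over blocks of bounded length. -/
theorem ExpMoment.exists_block_exp_moment (h : ExpMoment K β M) {ε : ℝ} (hε : 0 < ε) {m : ℕ}
    (hm : ∀ n, m ≤ n → ∀ μ : ℕ → ProbabilityMeasure (SL d), (∀ i, μ i ∈ K) →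
      ∀ v : E d, ‖v‖ = 1 → L μ n - ∫ A, Real.log ‖act A v‖ ∂conv μ n ≤ ε * n) (b : ℕ) :
    ∃ s₀ : ℝ, 0 < s₀ ∧ ∀ n, m ≤ n → 1 ≤ n → n ≤ b →
      ∀ μ : ℕ → ProbabilityMeasure (SL d), (∀ i, μ i ∈ K) → ∀ v : E d, ‖v‖ = 1 →
        ∀ s : ℝ, |s| ≤ s₀ →
          ∫⁻ A, ENNReal.ofReal (Real.exp (s * (Real.log ‖act A v‖ - L μ n))) ∂conv μ n ≤
            ENNReal.ofReal (Real.exp (2 * |s| * ε * n)) := by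
  have hβ := h.pos
  have hM : 0 < M := one_pos.trans_le h.one_le
  set C := M / β with hC
  have hC0 : 0 < C := div_pos hM hβ
  set Q : ℝ := 8 / β ^ 2 * (Real.exp (β * (b * C)) * M ^ b) with hQ
  have hQ0 : 0 < Q := by positivity
  -- Half of the exponent `β` bounds `exp |s X|`, the other half the factor `X ^ 2`. The bound `ε /
  -- Q` makes the quadratic term at most `|s| * ε`; `Q` depends on `b` through `M ^ b`, so block
  -- lengths must stay bounded.
  refine ⟨min (β / 2) (ε / Q), by positivity, fun n hmn hn1 hnb μ hμ v hv s hs => ?_⟩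
  have hsβ : |s| ≤ β / 2 := hs.trans (min_le_left _ _)
  have hsQ : |s| * Q ≤ ε := by
    have := hs.trans (min_le_right _ _)
    rwa [le_div_iff₀ hQ0] at this
  have hnb' : (n : ℝ) ≤ b := Nat.cast_le.2 hnb
  set X : SL d → ℝ := fun A => Real.log ‖act A v‖ - L μ n with hX
  have hXint : Integrable X (conv μ n) :=
    (h.integrable_log_norm_apply hμ n hv).sub (integrable_const _)
  have hXmeas : Measurable X := (measurable_norm_act_apply v).log.sub_const _
  have hXabs : ∀ A, |X A| ≤ height A + b * C := fun A => by
    refine (abs_sub _ _).trans (add_le_add (abs_log_norm_act_apply_le A hv) ?_)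
    exact (h.abs_L_le hμ n).trans (by gcongr)
  have hexpX : ∀ A, Real.exp (β * |X A|) ≤ Real.exp (β * (b * C)) * Real.exp (β * height A) := by
    intro A
    rw [← Real.exp_add, ← mul_add]
    exact Real.exp_le_exp.2 (by have := hXabs A; gcongr; linarith)
  have hsX : ∀ A, |s * X A| ≤ β / 2 * |X A| := fun A => by
    rw [abs_mul]; gcongr
  have hpt : ∀ A, Real.exp (s * X A) ≤
      1 + s * X A + s ^ 2 * (8 / β ^ 2 * (Real.exp (β * (b * C)) * Real.exp (β * height A))) := by
    intro A
    refine (exp_le_one_add_add_sq_mul_exp_abs _).trans ?_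
    rw [mul_pow, mul_assoc (s ^ 2)]
    refine add_le_add_right (mul_le_mul_of_nonneg_left ?_ (sq_nonneg s)) _
    have h1 : (β / 2 * |X A|) ^ 2 / 2 ≤ Real.exp (β / 2 * |X A|) := by
      have hnn : 0 ≤ β / 2 * |X A| := by positivity
      linarith [Real.quadratic_le_exp_of_nonneg hnn]
    have h2 : X A ^ 2 ≤ 8 / β ^ 2 * Real.exp (β / 2 * |X A|) := by
      rw [mul_pow, sq_abs] at h1
      calc X A ^ 2 = 8 / β ^ 2 * ((β / 2) ^ 2 * X A ^ 2 / 2) := by field_simp; ring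
        _ ≤ _ := by gcongr
    calc X A ^ 2 * Real.exp |s * X A|
        ≤ 8 / β ^ 2 * Real.exp (β / 2 * |X A|) * Real.exp (β / 2 * |X A|) := by
          gcongr; exact hsX A
      _ = 8 / β ^ 2 * Real.exp (β * |X A|) := by
          rw [mul_assoc, ← Real.exp_add]; ring_nf
      _ ≤ _ := by gcongr; exact hexpX A
  have hi : Integrable (fun A => 1 + s * X A) (conv μ n) :=
    (integrable_const _).add (hXint.const_mul s)
  have hdom : Integrable (fun A => 1 + s * X A +
      s ^ 2 * (8 / β ^ 2 * (Real.exp (β * (b * C)) * Real.exp (β * height A)))) (conv μ n) :=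
    hi.add
      ((((h.integrable_exp hμ n).const_mul _).const_mul _).const_mul _)
  have hEX : s * ∫ A, X A ∂conv μ n ≤ |s| * (ε * n) := by
    have h1 : |∫ A, X A ∂conv μ n| ≤ ε * n := by
      rw [integral_sub (h.integrable_log_norm_apply hμ n hv) (integrable_const _), integral_const]
      have h2 := hm n hmn μ hμ v hv
      have h3 := h.integral_le_L hμ n hv
      rw [abs_le]
      constructor
      · simp; linarith
      · have : 0 ≤ ε * n := by positivity
        simp; linarith
    exact (le_abs_self _).trans (by rw [abs_mul]; gcongr)
  have hint : ∫ A, Real.exp (s * X A) ∂conv μ n ≤ Real.exp (2 * |s| * ε * n) := by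
    calc ∫ A, Real.exp (s * X A) ∂conv μ n
        ≤ ∫ A, (1 + s * X A + s ^ 2 * (8 / β ^ 2 *
            (Real.exp (β * (b * C)) * Real.exp (β * height A)))) ∂conv μ n :=
          integral_mono_of_nonneg (Eventually.of_forall fun A => (Real.exp_pos _).le) hdom
            (Eventually.of_forall hpt)
      _ = 1 + s * ∫ A, X A ∂conv μ n + s ^ 2 * (8 / β ^ 2 *
            (Real.exp (β * (b * C)) * ∫ A, Real.exp (β * height A) ∂conv μ n)) := by
          rw [integral_add hi
            ((((h.integrable_exp hμ n).const_mul _).const_mul _).const_mul _),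
            integral_add (integrable_const _) (hXint.const_mul s)]
          simp only [integral_const_mul, integral_const]
          simp
      _ ≤ 1 + |s| * (ε * n) + s ^ 2 * Q := by
          rw [hQ]
          gcongr
          exact (h.integral_exp_le hμ n).trans (pow_le_pow_right₀ h.one_le hnb)
      _ ≤ 1 + 2 * |s| * ε * n := by
          have h1 : (1 : ℝ) ≤ n := by exact_mod_cast hn1
          have h2 : s ^ 2 * Q ≤ |s| * (ε * n) := by
            rw [← sq_abs, sq, mul_assoc]
            exact mul_le_mul_of_nonneg_left (hsQ.trans (le_mul_of_one_le_right hε.le h1))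
              (abs_nonneg s)
          linarith
      _ ≤ _ := by linarith [Real.add_one_le_exp (2 * |s| * ε * n)]
  have hexpint : Integrable (fun A => Real.exp (s * X A)) (conv μ n) :=
    hdom.mono' (hXmeas.const_mul s).exp.aestronglyMeasurable (Eventually.of_forall fun A => by
      rw [Real.norm_of_nonneg (Real.exp_pos _).le]; exact hpt A)
  rw [← ofReal_integral_eq_lintegral_ofReal hexpint
    (Eventually.of_forall fun A => (Real.exp_pos _).le)]
  exact ENNReal.ofReal_le_ofReal hint

/-- Exponential moments of the logarithm, centred at a suitable number, for all long products. -/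
theorem ExpMoment.exists_center_exp_moment (h : ExpMoment K β M) (hK : IsCompact K)
    (hspaces : SpacesCondition K) {ε : ℝ} (hε : 0 < ε) :
    ∃ m : ℕ, ∃ s₀ : ℝ, 0 < s₀ ∧ ∀ n, m ≤ n →
      ∀ μ : ℕ → ProbabilityMeasure (SL d), (∀ i, μ i ∈ K) →
      (∀ v : E d, ‖v‖ = 1 → |∫ A, Real.log ‖act A v‖ ∂conv μ n - L μ n| ≤ ε * n) ∧
      ∃ Λ : ℝ, ∀ v : E d, ‖v‖ = 1 → ∀ s : ℝ, |s| ≤ s₀ →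
        ∫⁻ A, ENNReal.ofReal (Real.exp (s * (Real.log ‖act A v‖ - Λ))) ∂conv μ n ≤
          ENNReal.ofReal (Real.exp (2 * |s| * ε * n)) := by
  obtain ⟨m₀, hm₀⟩ := h.exists_L_sub_integral_le hK hspaces hε
  -- The added one keeps blocks nonempty, so that removing a block shortens the product.
  set m := m₀ + 1 with hmdef
  obtain ⟨s₀, hs₀, hblock⟩ := h.exists_block_exp_moment hε hm₀ (2 * m)
  refine ⟨m, s₀, hs₀, fun n hn μ hμ => ⟨fun v hv => ?_, ?_⟩⟩
  · have h1 := hm₀ n (by omega) μ hμ v hv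
    have h2 := h.integral_le_L hμ n hv
    have h3 : 0 ≤ ε * n := by positivity
    exact abs_le.2 ⟨by linarith, by linarith⟩
  induction n using Nat.strong_induction_on generalizing μ with
  | _ n ih =>
  rcases le_or_gt n (2 * m) with hn2 | hn2
  · exact ⟨L μ n, fun v hv s hs => hblock n (by omega) (by omega) hn2 μ hμ v hv s hs⟩
  -- Split off the first `m` matrices; more than `m` remain, and the final block has length between
  -- `m` and `2 * m`.
  obtain ⟨r, rfl⟩ := Nat.exists_eq_add_of_le hn
  obtain ⟨Λ, hΛ⟩ := ih r (by omega) (by omega) (fun i => μ (m + i)) fun i => hμ _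
  refine ⟨L μ m + Λ, fun v hv s hs => ?_⟩
  have hv0 : v ≠ 0 := by rintro rfl; simp at hv
  set F : SL d → ℝ≥0∞ :=
    fun A => ENNReal.ofReal (Real.exp (s * (Real.log ‖act A v‖ - (L μ m + Λ)))) with hF
  have hFm : Measurable F :=
    ((((measurable_norm_act_apply v).log.sub_const _).const_mul s).exp).ennreal_ofReal
  have hsplit : ∀ B T : SL d, F (B * T) =
      ENNReal.ofReal (Real.exp (s * (Real.log ‖act T v‖ - L μ m))) *
      ENNReal.ofReal (Real.exp (s * (Real.log ‖act B (‖act T v‖⁻¹ • act T v)‖ - Λ))) := by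
    intro B T
    have hT : 0 < ‖act T v‖ := norm_pos_iff.2 (act_ne_zero T hv0)
    have hB : 0 < ‖act B (act T v)‖ := norm_pos_iff.2 (act_ne_zero B (act_ne_zero T hv0))
    rw [← ENNReal.ofReal_mul (Real.exp_pos _).le, ← Real.exp_add, map_smul, norm_smul, norm_inv,
      norm_norm, Real.log_mul (inv_ne_zero hT.ne') hB.ne', Real.log_inv]
    simp only [hF, act_mul]
    ring_nf
  have hFmul : Measurable fun p : SL d × SL d => F (p.1 * p.2) := hFm.comp measurable_mul
  rw [conv_add, Measure.lintegral_mconv_eq_lintegral_prod hFm,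
    lintegral_prod_symm _ hFmul.aemeasurable]
  -- For fixed `T`, integrate over `B` first. The centre `Λ` does not depend on the vector, so the
  -- inductive bound applies to the random direction of `T v`.
  calc _ ≤ ∫⁻ T, ENNReal.ofReal (Real.exp (s * (Real.log ‖act T v‖ - L μ m))) *
        ENNReal.ofReal (Real.exp (2 * |s| * ε * r)) ∂conv μ m := by
        refine lintegral_mono fun T => ?_
        have hT : 0 < ‖act T v‖ := norm_pos_iff.2 (act_ne_zero T hv0)
        have hu : ‖‖act T v‖⁻¹ • act T v‖ = 1 := by
          rw [norm_smul, norm_inv, norm_norm, inv_mul_cancel₀ hT.ne']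
        simp only [hsplit]
        rw [lintegral_const_mul _ ((((measurable_norm_act_apply _).log.sub_const _).const_mul
          s).exp).ennreal_ofReal]
        gcongr
        exact hΛ _ hu s hs
    _ = (∫⁻ T, ENNReal.ofReal (Real.exp (s * (Real.log ‖act T v‖ - L μ m))) ∂conv μ m) *
        ENNReal.ofReal (Real.exp (2 * |s| * ε * r)) :=
        lintegral_mul_const _ ((((measurable_norm_act_apply _).log.sub_const _).const_mul
          s).exp).ennreal_ofReal
    _ ≤ ENNReal.ofReal (Real.exp (2 * |s| * ε * m)) * ENNReal.ofReal (Real.exp (2 * |s| * ε * r)) := by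
        gcongr
        exact hblock m (by omega) (by omega) (by omega) μ hμ v hv s hs
    _ = _ := by
        rw [← ENNReal.ofReal_mul (Real.exp_pos _).le, ← Real.exp_add]
        push_cast
        ring_nf

end Blocks

/-! ### Deviation estimates -/

/-- The exponential Markov inequality. -/
theorem measure_lt_le_of_lintegral_exp_le {Ω : Type*} [MeasurableSpace Ω] {ρ : Measure Ω}
    {X : Ω → ℝ} (hX : Measurable X) {s t b : ℝ} (hs : 0 ≤ s)
    (h : ∫⁻ ω, ENNReal.ofReal (Real.exp (s * X ω)) ∂ρ ≤ ENNReal.ofReal (Real.exp b)) :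
    ρ {ω | t < X ω} ≤ ENNReal.ofReal (Real.exp (b - s * t)) := by
  have hm : Measurable fun ω => ENNReal.ofReal (Real.exp (s * X ω)) :=
    ((hX.const_mul s).exp).ennreal_ofReal
  have h1 := (mul_meas_ge_le_lintegral (μ := ρ) hm (ENNReal.ofReal (Real.exp (s * t)))).trans h
  have hpos : 0 < ENNReal.ofReal (Real.exp (s * t)) := ENNReal.ofReal_pos.2 (Real.exp_pos _)
  rw [Real.exp_sub, ENNReal.ofReal_div_of_pos (Real.exp_pos _),
    ENNReal.le_div_iff_mul_le (Or.inl hpos.ne') (Or.inl ENNReal.ofReal_ne_top), mul_comm]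
  refine le_trans ?_ h1
  refine mul_le_mul' le_rfl (measure_mono fun ω (hω : t < X ω) => ?_)
  exact ENNReal.ofReal_le_ofReal (Real.exp_le_exp.2 (mul_le_mul_of_nonneg_left hω.le hs))

theorem norm_act_le_sum (A : SL d) : ‖act A‖ ≤ ∑ i, ‖act A (EuclideanSpace.single i 1)‖ := by
  refine ContinuousLinearMap.opNorm_le_bound _ (by positivity) fun v => ?_
  have hv : v = ∑ i, v i • EuclideanSpace.single i (1 : ℝ) := by
    simpa using ((EuclideanSpace.basisFun (Fin d) ℝ).sum_repr v).symm
  conv_lhs => rw [hv, map_sum]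
  rw [Finset.sum_mul]
  refine (norm_sum_le _ _).trans (Finset.sum_le_sum fun i _ => ?_)
  rw [map_smul, norm_smul, mul_comm]
  gcongr
  exact PiLp.norm_apply_le v i

section Deviations

variable [NeZero d] {K : Set (ProbabilityMeasure (SL d))} {β M : ℝ}

/-- Jensen with both signs of `s` puts the mean of `log |T_n v|` within `2 η n` of `Λ`, and it is
within `η n` of `L_n`. Thus a deviation `6 η n` from `L_n` forces one of `3 η n` from `Λ`, where
Markov leaves `exp (2 s η n - 3 s η n)`. -/
theorem ExpMoment.exists_vector_deviation (h : ExpMoment K β M) (hK : IsCompact K)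
    (hspaces : SpacesCondition K) {ε : ℝ} (hε : 0 < ε) :
    ∃ δ : ℝ, 0 < δ ∧ ∃ m : ℕ, ∀ n, m ≤ n →
      ∀ μ : ℕ → ProbabilityMeasure (SL d), (∀ i, μ i ∈ K) → ∀ v : E d, ‖v‖ = 1 →
        conv μ n {A | ε * n < |Real.log ‖act A v‖ - L μ n|} ≤
          ENNReal.ofReal (2 * Real.exp (-δ * n)) := by
  set η := ε / 6 with hη
  have hη0 : 0 < η := by positivity
  obtain ⟨m, s, hs, hmain⟩ := h.exists_center_exp_moment hK hspaces hη0
  refine ⟨s * η, by positivity, m, fun n hn μ hμ v hv => ?_⟩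
  obtain ⟨hmean, Λ, hΛ⟩ := hmain n hn μ hμ
  set X : SL d → ℝ := fun A => Real.log ‖act A v‖ - Λ with hX
  have hXm : Measurable X := (measurable_norm_act_apply v).log.sub_const _
  have hXint : Integrable X (conv μ n) :=
    (h.integrable_log_norm_apply hμ n hv).sub (integrable_const _)
  have hplus : ∫⁻ A, ENNReal.ofReal (Real.exp (s * X A)) ∂conv μ n ≤
      ENNReal.ofReal (Real.exp (2 * s * η * n)) := by
    have := hΛ v hv s (abs_of_pos hs).le
    rwa [abs_of_pos hs] at this
  have hminus : ∫⁻ A, ENNReal.ofReal (Real.exp (s * -X A)) ∂conv μ n ≤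
      ENNReal.ofReal (Real.exp (2 * s * η * n)) := by
    have := hΛ v hv (-s) (by rw [abs_neg, abs_of_pos hs])
    rw [abs_neg, abs_of_pos hs] at this
    simpa only [hX, neg_mul, mul_neg] using this
  have jensen : ∀ Y : SL d → ℝ, Measurable Y → Integrable Y (conv μ n) →
      ∫⁻ A, ENNReal.ofReal (Real.exp (s * Y A)) ∂conv μ n ≤
        ENNReal.ofReal (Real.exp (2 * s * η * n)) → ∫ A, Y A ∂conv μ n ≤ 2 * (η * n) := by
    intro Y hY hYint hle
    have hnn : 0 ≤ᵐ[conv μ n] fun A => Real.exp (s * Y A) :=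
      Eventually.of_forall fun A => (Real.exp_pos _).le
    have hme := ((hY.const_mul s).exp).aestronglyMeasurable (μ := conv μ n)
    have hi : Integrable (fun A => Real.exp (s * Y A)) (conv μ n) :=
      ⟨hme, (hasFiniteIntegral_iff_ofReal hnn).2 (hle.trans_lt ENNReal.ofReal_lt_top)⟩
    have h1 := convexOn_exp.map_integral_le Real.continuous_exp.continuousOn isClosed_univ
      (Eventually.of_forall fun _ => mem_univ _) (hYint.const_mul s) hi
    have h2 : ∫ A, Real.exp (s * Y A) ∂conv μ n ≤ Real.exp (2 * s * η * n) := by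
      rw [integral_eq_lintegral_of_nonneg_ae hnn hme]
      exact ENNReal.toReal_le_of_le_ofReal (Real.exp_pos _).le hle
    have h3 := Real.exp_le_exp.1 (h1.trans h2)
    rw [integral_const_mul] at h3
    refine le_of_mul_le_mul_left (h3.trans_eq ?_) hs
    ring
  have hXmean : ∫ A, X A ∂conv μ n = ∫ A, Real.log ‖act A v‖ ∂conv μ n - Λ := by
    rw [integral_sub (h.integrable_log_norm_apply hμ n hv) (integrable_const _), integral_const]
    simp
  have j1 := jensen X hXm hXint hplus
  have j2 := jensen (fun A => -X A) hXm.neg hXint.neg hminus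
  rw [integral_neg] at j2
  rw [hXmean] at j1 j2
  have h3 := abs_le.1 (hmean v hv)
  have hsub : {A | ε * n < |Real.log ‖act A v‖ - L μ n|} ⊆
      {A | 3 * η * n < X A} ∪ {A | 3 * η * n < -X A} := by
    intro A hA
    have hA' : 6 * η * n < |Real.log ‖act A v‖ - L μ n| := by
      rw [show 6 * η = ε by rw [hη]; ring]; exact hA
    rcases lt_abs.1 hA' with hA' | hA'
    · exact Or.inl (show 3 * η * n < Real.log ‖act A v‖ - Λ by linarith [h3.1, h3.2])
    · exact Or.inr (show 3 * η * n < -(Real.log ‖act A v‖ - Λ) by linarith [h3.1, h3.2])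
  have e : 2 * s * η * n - s * (3 * η * n) = -(s * η) * n := by ring
  have m1 := measure_lt_le_of_lintegral_exp_le (t := 3 * η * n) hXm hs.le hplus
  have m2 := measure_lt_le_of_lintegral_exp_le (t := 3 * η * n) hXm.neg hs.le hminus
  rw [e] at m1 m2
  refine (measure_mono hsub).trans ((measure_union_le _ _).trans ((add_le_add m1 m2).trans_eq ?_))
  rw [← ENNReal.ofReal_add (Real.exp_pos _).le (Real.exp_pos _).le]
  ring_nf

theorem exists_log_norm_act_le (A : SL d) :
    ∃ i, Real.log ‖act A‖ ≤ Real.log d + Real.log ‖act A (EuclideanSpace.single i 1)‖ := by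
  obtain ⟨i, -, hi⟩ := Finset.exists_max_image Finset.univ
    (fun i => ‖act A (EuclideanSpace.single i 1)‖) Finset.univ_nonempty
  have hd : (0 : ℝ) < d := by exact_mod_cast NeZero.pos d
  have h0 : EuclideanSpace.single i (1 : ℝ) ≠ 0 := by simp
  have h1 : 0 < ‖act A (EuclideanSpace.single i 1)‖ := norm_pos_iff.2 (act_ne_zero A h0)
  refine ⟨i, ?_⟩
  rw [← Real.log_mul hd.ne' h1.ne']
  refine Real.log_le_log (norm_act_pos A) ((norm_act_le_sum A).trans ?_)
  simpa using Finset.sum_le_card_nsmul Finset.univ _ _ hi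

/-- If the norm is too large, so is the image of some basis vector, up to `log d`, which half of `ε
n` absorbs. If it is too small, so is the image of every unit vector. A union bound over the basis
costs the factor `d`. -/
theorem ExpMoment.exists_norm_deviation (h : ExpMoment K β M) (hK : IsCompact K)
    (hspaces : SpacesCondition K) {ε : ℝ} (hε : 0 < ε) :
    ∃ δ : ℝ, 0 < δ ∧ ∃ m : ℕ, ∀ n, m ≤ n →
      ∀ μ : ℕ → ProbabilityMeasure (SL d), (∀ i, μ i ∈ K) →
        conv μ n {A | ε * n < |Real.log ‖act A‖ - L μ n|} ≤
          ENNReal.ofReal (d * (2 * Real.exp (-δ * n))) := by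
  obtain ⟨δ, hδ, m, hm⟩ := h.exists_vector_deviation hK hspaces (half_pos hε)
  obtain ⟨m', hm'⟩ := exists_nat_ge (Real.log d / (ε / 2))
  refine ⟨δ, hδ, max m m', fun n hn μ hμ => ?_⟩
  have hlog : Real.log d ≤ ε / 2 * n := by
    rw [div_le_iff₀ (half_pos hε)] at hm'
    have : (m' : ℝ) ≤ n := Nat.cast_le.2 ((le_max_right _ _).trans hn)
    nlinarith
  have hsub : {A : SL d | ε * n < |Real.log ‖act A‖ - L μ n|} ⊆
      ⋃ i : Fin d, {A | ε / 2 * n < |Real.log ‖act A (EuclideanSpace.single i 1)‖ - L μ n|} := by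
    intro A hA
    rw [mem_iUnion]
    rcases lt_abs.1 (show ε * n < |Real.log ‖act A‖ - L μ n| from hA) with hA | hA
    · obtain ⟨i, hi⟩ := exists_log_norm_act_le A
      exact ⟨i, show ε / 2 * n < |Real.log ‖act A (EuclideanSpace.single i 1)‖ - L μ n| from
        lt_abs.2 (Or.inl (by linarith))⟩
    · have hone : ‖EuclideanSpace.single (0 : Fin d) (1 : ℝ)‖ = 1 := by simp
      have hi := log_norm_act_apply_le (A := A) hone
      have h0 : 0 ≤ ε * n := by positivity
      exact ⟨0, show ε / 2 * n < |Real.log ‖act A (EuclideanSpace.single 0 1)‖ - L μ n| from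
        lt_abs.2 (Or.inr (by linarith))⟩
  refine (measure_mono hsub).trans ((measure_iUnion_fintype_le _ _).trans ?_)
  refine (Finset.sum_le_sum fun i _ =>
    hm n ((le_max_left _ _).trans hn) μ hμ _ (by simp)).trans_eq ?_
  rw [Finset.sum_const, Finset.card_univ, Fintype.card_fin, nsmul_eq_mul,
    ENNReal.ofReal_mul (Nat.cast_nonneg d), ENNReal.ofReal_natCast]

end Deviations

/-- Halving the rate absorbs the constant factors and makes the final inequalities strict. -/
theorem eventually_const_mul_exp_lt (c : ℝ) {δ : ℝ} (hδ : 0 < δ) :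
    ∀ᶠ n : ℕ in atTop, c * Real.exp (-δ * n) < Real.exp (-(δ / 2) * n) := by
  have hlim : Tendsto (fun n : ℕ => Real.exp (δ / 2 * n)) atTop atTop :=
    Real.tendsto_exp_atTop.comp (tendsto_natCast_atTop_atTop.const_mul_atTop (half_pos hδ))
  filter_upwards [hlim.eventually_gt_atTop c] with n hn
  calc c * Real.exp (-δ * n) < Real.exp (δ / 2 * n) * Real.exp (-δ * n) := by gcongr
    _ = Real.exp (-(δ / 2) * n) := by rw [← Real.exp_add]; ring_nf

theorem law_setOf_prodT (μ : ℕ → ProbabilityMeasure (SL d)) (n : ℕ) {f : SL d → ℝ}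
    (hf : Measurable f) (a b : ℝ) :
    law μ n {A | a < |f (prodT A) - b|} = conv μ n {A | a < |f A - b|} := by
  have hs : MeasurableSet {A : SL d | a < |f A - b|} :=
    measurableSet_lt measurable_const ((hf.sub_const b).abs)
  rw [← map_prodT_law, Measure.map_apply (continuous_prodT n).measurable hs]
  rfl

end NonstatFurstenberg

end

/-- Large deviations for nonstationary products. The spaces condition alone makes the direction of
`T_k v` spread out away from every hyperplane, which is all that is needed to compare `|T_n v|` with
`‖T_n‖`; the measures condition only serves to make `L_n` grow linearly, and is not used. -/
theorem theorem1p3 (d : ℕ)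
    (K : Set (ProbabilityMeasure (NonstatFurstenberg.SL d))) (hK : IsCompact K)
    (hmom : NonstatFurstenberg.FiniteMoment K)
    (hmeas : NonstatFurstenberg.MeasuresCondition K)
    (hspaces : NonstatFurstenberg.SpacesCondition K) :
    -- the expectations `L_n` are well defined
    (∀ (μ : ℕ → ProbabilityMeasure (NonstatFurstenberg.SL d)), (∀ i, μ i ∈ K) → ∀ n : ℕ,
      Integrable (fun A : Fin n → NonstatFurstenberg.SL d =>
        Real.log ‖NonstatFurstenberg.act (NonstatFurstenberg.prodT A)‖)
        (NonstatFurstenberg.law μ n)) ∧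
    ∀ ε : ℝ, 0 < ε → ∃ δ : ℝ, 0 < δ ∧ ∃ N : ℕ, ∀ n : ℕ, N ≤ n →
      ∀ μ : ℕ → ProbabilityMeasure (NonstatFurstenberg.SL d), (∀ i, μ i ∈ K) →
        NonstatFurstenberg.law μ n
          {A | ε * n < |Real.log ‖NonstatFurstenberg.act (NonstatFurstenberg.prodT A)‖
            - NonstatFurstenberg.L μ n|} < ENNReal.ofReal (Real.exp (-δ * n)) ∧
        ∀ v₀ : NonstatFurstenberg.E d, ‖v₀‖ = 1 →
          NonstatFurstenberg.law μ n
            {A | ε * n < |Real.log ‖NonstatFurstenberg.act (NonstatFurstenberg.prodT A) v₀‖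
              - NonstatFurstenberg.L μ n|} < ENNReal.ofReal (Real.exp (-δ * n)) := by
  open NonstatFurstenberg Filter in
  rcases Nat.eq_zero_or_pos d with rfl | hd
  -- In dimension zero every norm is `0` and `Real.log 0 = 0`, so the norm event is empty; there are
  -- no unit vectors.
  · have hlog : ∀ A : SL 0, Real.log ‖act A‖ = 0 := fun A => by
      rw [Subsingleton.elim (act A) 0, norm_zero, Real.log_zero]
    have hL : ∀ (μ : ℕ → ProbabilityMeasure (SL 0)) (n : ℕ), L μ n = 0 := fun μ n => by
      simp [L]
    refine ⟨fun μ _ n => by simp, fun ε hε => ⟨1, one_pos, 0, fun n _ μ _ => ⟨?_, ?_⟩⟩⟩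
    · have hn : ¬ ε * n < 0 := not_lt.2 (by positivity)
      simp only [hlog, hL, sub_zero, abs_zero, hn, Set.ofPred_false, measure_empty]
      exact ENNReal.ofReal_pos.2 (Real.exp_pos _)
    · intro v hv
      rw [Subsingleton.elim v 0, norm_zero] at hv
      exact absurd hv zero_ne_one
  · have : NeZero d := ⟨hd.ne'⟩
    obtain ⟨β, M, h⟩ := exists_expMoment hmom
    refine ⟨fun μ hμ n => ?_, fun ε hε => ?_⟩
    · have hi := h.integrable_log_norm hμ n
      rw [← map_prodT_law] at hi
      exact hi.comp_measurable (continuous_prodT n).measurable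
    obtain ⟨δ₁, hδ₁, m₁, h₁⟩ := h.exists_norm_deviation hK hspaces hε
    obtain ⟨δ₂, hδ₂, m₂, h₂⟩ := h.exists_vector_deviation hK hspaces hε
    obtain ⟨δ, hδ, hle₁, hle₂⟩ : ∃ δ, 0 < δ ∧ δ ≤ δ₁ ∧ δ ≤ δ₂ :=
      ⟨min δ₁ δ₂, lt_min hδ₁ hδ₂, min_le_left _ _, min_le_right _ _⟩
    obtain ⟨m₃, h₃⟩ := eventually_atTop.1 ((eventually_const_mul_exp_lt (d * 2) hδ).and
      (eventually_const_mul_exp_lt 2 hδ))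
    refine ⟨δ / 2, half_pos hδ, max m₁ (max m₂ m₃), fun n hn μ hμ => ?_⟩
    rw [max_le_iff, max_le_iff] at hn
    obtain ⟨hn₁, hn₂, hn₃⟩ := hn
    have hpos := Real.exp_pos (-(δ / 2) * n)
    refine ⟨?_, fun v hv => ?_⟩
    · rw [law_setOf_prodT μ n measurable_log_norm_act]
      refine (h₁ n hn₁ μ hμ).trans_lt ((ENNReal.ofReal_lt_ofReal_iff hpos).2 ?_)
      refine lt_of_le_of_lt ?_ (h₃ n hn₃).1
      rw [mul_assoc]
      gcongr
    · rw [law_setOf_prodT μ n (f := fun A => Real.log ‖act A v‖)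
        (measurable_norm_act_apply v).log]
      refine (h₂ n hn₂ μ hμ v hv).trans_lt ((ENNReal.ofReal_lt_ofReal_iff hpos).2 ?_)
      refine lt_of_le_of_lt ?_ (h₃ n hn₃).2
      gcongr
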